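/- Let $B=(B_s)_{s\ge 0}$ be a standard Brownian motion on $\mathbb{R}^d$ started at $0$, and let $S=(S_t)_{t\ge 0}$ be a subordinator (a $[0,\infty)$-valued Lévy process with nondecreasing paths, $S_0=0$) that is independent of $B$. For $z\in\mathbb{R}^d$ put $B^z_s:=z+B_s$. Let $x,y\in\mathbb{R}^d$, and let $L^x$, $L^y$ be subordinated Brownian motions started at $x$ and $y$, i.e. processes with the laws of $(B^x_{S_t})_{t\ge0}$ and $(B^y_{S_t})_{t\ge0}$, respectively. Let $d_{TV}(X,Y):=\sup_A|\mathbb{P}(X\in A)-\mathbb{P}(Y\in A)|$ with the supremum over all Borel sets $A$, and for $r>0$, $t\ge0$ let $$p_t(r):=\int_{(0,\infty)}\frac{1}{(2\pi)^{\frac{d-1}{2}}}\frac{1}{\sqrt{2\pi s}}\,e^{-\frac{r^2}{2s}}\;\mathbb{P}(S_t\in ds).$$ Let $H_{x,y}:=\{z:|x-z|=|y-z|\}$, let $R_{x,y}z:=z-2\langle z-\frac{x+y}{2},x-y\rangle\frac{x-y}{|x-y|^2}$ if $x\ne y$ and $R_{x,x}z:=z$, and let $\tau:=\inf\{s>0: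 B^x_s\in H_{x,y}\}$ (so $\tau=0$ if $x=y$). The reflection coupling of Brownian motions started at $x$ and $y$ is $(\widetilde B^x,\widetilde B^y)$, where $\widetilde B^x_s:=B^x_s$, and $\widetilde B^y_s:=R_{x,y}B^x_s$ for $s<\tau$, $\widetilde B^y_s:=B^x_s$ for $s\ge\tau$. Let $$T:=\inf\{t\ge 0:\ \widetilde B^x_{S_t}=\widetilde B^y_{S_t}\}$$ be the coupling time of the subordinated reflection coupled Brownian motion $(\widetilde B^x_{S_t},\widetilde B^y_{S_t})_{t\ge0}$. Then for every $t\ge 0$ the function $p_t$ is integrable on $(0,\frac{|x-y|}{2})$, $\{T>t\}$ is an event (up to a null set), and $$d_{TV}(L^x_t,L^y_t)=\mathbb{P}(S_t=0)\,(1-\delta_x(y))+2(2\pi)^{\frac{d-1}{2}}\int_0^{\frac{|x-y|}{2}}p_t(r)\,dr=\mathbb{P}(T>t),$$ where $\delta_x(y)=1$ if $x=y$ and $0$ otherwise. Moreover, $(\widetilde B^x_{S_\cdot},\widetilde B^y_{S_\cdot})$ is a maximal coupling of $L^x$ and $L^y$: $(\widetilde B^x_{S_t})_{t\ge0}$ has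 the law of $L^x$, $(\widetilde B^y_{S_t})_{t\ge0}$ has the law of $L^y$, and $d_{TV}(L^x_t,L^y_t)=\mathbb{P}(\widetilde B^x_{S_t}\neq\widetilde B^y_{S_t})$ for all $t\ge0$. -/

import Mathlib

open MeasureTheory ProbabilityTheory Filter Topology
open scoped NNReal ENNReal RealInnerProductSpace

/-- Total variation distance `sup_A |μ A - ν A|`, the supremum being over all measurable sets. -/
noncomputable def tvDist {E : Type*} [MeasurableSpace E] (μ ν : Measure E) : ℝ :=
  ⨆ A : {A : Set E // MeasurableSet A}, |μ.real A.1 - ν.real A.1|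

/-- Standard Brownian motion on `ℝ^d` started at the origin. -/
structure IsBrownianMotion {d : ℕ} {Ω : Type*} [MeasurableSpace Ω]
    (B : ℝ≥0 → Ω → EuclideanSpace ℝ (Fin d)) (P : Measure Ω) : Prop where
  measurable : ∀ t, Measurable (B t)
  start : ∀ᵐ ω ∂P, B 0 ω = 0
  indep : HasIndepIncrements B P
  /-- the increments over an interval of length `h` are centered Gaussian with covariance `h • 1` -/
  gaussian : ∀ s h : ℝ≥0, HasLaw (fun ω => B (s + h) ω - B s ω)
    ((stdGaussian (EuclideanSpace ℝ (Fin d))).map (fun z => √(h : ℝ) • z)) P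
  continuous : ∀ᵐ ω ∂P, Continuous (fun t => B t ω)

/-- Lévy process started at the origin: stationary and independent increments and stochastic
continuity. -/
structure IsLevyProcess {E : Type*} [NormedAddCommGroup E] [MeasurableSpace E] {Ω : Type*}
    [MeasurableSpace Ω] (X : ℝ≥0 → Ω → E) (P : Measure Ω) : Prop where
  measurable : ∀ t, Measurable (X t)
  start : ∀ᵐ ω ∂P, X 0 ω = 0
  indep : HasIndepIncrements X P
  stationary : ∀ s h : ℝ≥0,
    IdentDistrib (fun ω => X (s + h) ω - X s ω) (fun ω => X h ω - X 0 ω) P P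
  stochCont : ∀ t : ℝ≥0, TendstoInMeasure P X (𝓝 t) (X t)

/-- Subordinator: a real-valued Lévy process with nondecreasing paths (it starts at `0`, so it takes
values in `[0, ∞)`). -/
structure IsSubordinator {Ω : Type*} [MeasurableSpace Ω] (S : ℝ≥0 → Ω → ℝ≥0) (P : Measure Ω) :
    Prop where
  levy : IsLevyProcess (fun t ω => (S t ω : ℝ)) P
  mono : ∀ᵐ ω ∂P, Monotone (fun t => S t ω)

/-- The process `X` run along the random clock `S`, i.e. `t ↦ X_{S_t}`. -/
def subordinate {Ω E : Type*} (X : ℝ≥0 → Ω → E) (S : ℝ≥0 → Ω → ℝ≥0) : ℝ≥0 → Ω → E :=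
  fun t ω => X (S t ω) ω

section Reflection

variable {E : Type*} [NormedAddCommGroup E] [InnerProductSpace ℝ E]

/-- The plane `H_{x,y}` of points at equal distance from `x` and `y`. -/
def midPlane (x y : E) : Set E := {z | ‖x - z‖ = ‖y - z‖}

/-- The reflection `R_{x,y}` at the plane `H_{x,y}`. For `x = y` this is the identity. -/
noncomputable def planeReflection (x y z : E) : E :=
  z - (2 * ⟪z - (2⁻¹ : ℝ) • (x + y), x - y⟫ / ‖x - y‖ ^ 2) • (x - y)

/-- The hitting time `inf {t > 0 : X_t ∈ H_{x,y}}`, infinite if there is no such `t`.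
For `x = y` the plane is the whole space and the infimum is `0`. -/
noncomputable def planeHittingTime {Ω : Type*} (x y : E) (X : ℝ≥0 → Ω → E) (ω : Ω) : ℝ≥0∞ :=
  ⨅ (t : ℝ≥0) (_ : 0 < t ∧ X t ω ∈ midPlane x y), (t : ℝ≥0∞)

open Classical in
/-- The process `X` reflected at `H_{x,y}` before it hits this plane, and equal to `X` from the
hitting time on. The reflection coupling is the pair of `X` and this process. -/
noncomputable def reflectedProcess {Ω : Type*} (x y : E) (X : ℝ≥0 → Ω → E) : ℝ≥0 → Ω → E :=
  fun t ω => if (t : ℝ≥0∞) < planeHittingTime x y X ω then planeReflection x y (X t ω) else X t ω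

end Reflection

/-- The coupling time `inf {t ≥ 0 : X_t = Y_t}`, infinite if the processes never meet. -/
noncomputable def couplingTime {Ω E : Type*} (X Y : ℝ≥0 → Ω → E) (ω : Ω) : ℝ≥0∞ :=
  ⨅ (t : ℝ≥0) (_ : X t ω = Y t ω), (t : ℝ≥0∞)

/-- `(X', Y')`, defined on one probability space, is a maximal coupling of the processes `X` and `Y`:
`X'` has the law of `X` and `Y'` has the law of `Y` (as processes, on the product sigma-algebra), and
at each time the total variation distance of the marginals is the probability that
`X'` and `Y'` differ. -/
structure IsMaximalCoupling {E Ω Ω₁ Ω₂ : Type*} [MeasurableSpace E] [MeasurableSpace Ω]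
    [MeasurableSpace Ω₁] [MeasurableSpace Ω₂] (X' Y' : ℝ≥0 → Ω → E) (P : Measure Ω)
    (X : ℝ≥0 → Ω₁ → E) (P₁ : Measure Ω₁) (Y : ℝ≥0 → Ω₂ → E) (P₂ : Measure Ω₂) : Prop where
  law_fst : IdentDistrib (fun ω t => X' t ω) (fun ω t => X t ω) P P₁
  law_snd : IdentDistrib (fun ω t => Y' t ω) (fun ω t => Y t ω) P P₂
  tv_eq : ∀ t : ℝ≥0, tvDist (P₁.map (X t)) (P₂.map (Y t)) = P.real {ω | X' t ω ≠ Y' t ω}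

/-- The function
`p(r) = ∫_{(0,∞)} (2π)^{-(d-1)/2} (2πs)^{-1/2} exp(-r²/(2s)) ν(ds)`
of a law `ν` on the line; it is used with the law of `S_t`. -/
noncomputable def subKernel (d : ℕ) (ν : Measure ℝ) (r : ℝ) : ℝ :=
  ∫ s in Set.Ioi (0 : ℝ), 1 / (2 * Real.pi) ^ (((d : ℝ) - 1) / 2) * (1 / √(2 * Real.pi * s))
    * Real.exp (-(r ^ 2 / (2 * s))) ∂ν

/-! Let A be the open half-space of points closer to x than to y. Before it hits the midplane, the
Brownian path from x lies in A and its mirror image does not; from the hitting time on the two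
processes agree. So almost surely `X t ≠ Y t` forces `X t ∈ A` and `Y t ∉ A`, whence P(X_t ∈ A) -
P(Y_t ∈ A) = P(X_t ≠ Y_t). The coupling inequality bounds the total variation distance by the same
number, so A attains the supremum (`tvDist_eq_of_ae`).

This needs the correct law of Y, that is, the reflection principle
(`IsBrownianMotion.map_reflectPath`). It is proved without the strong Markov property. On a grid of
mesh 1/n, an increment is reflected if the path has not hit the plane by the left end of its
interval. That decision is known from the past, while the increment is independent of the past and
invariant under isometries, so the joint law of the increments does not change. Letting n grow gives
the reflected path, by continuity. The independent clock S preserves equality of laws.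

For the formula, P(x + B_{S_t} ∈ A) - P(y + B_{S_t} ∈ A) is the probability that a one-dimensional
projection of B_{S_t} lies in a strip of half-width |x-y|/2. Conditioning on S_t gives centered
Gaussians of variance s; s = 0 yields the atom, and Fubini on s > 0 yields the integral of p_t.

Finally, X_t ≠ Y_t exactly when S_t < τ. Since S is monotone, this is T > t up to right-continuity
of S at t, which stochastic continuity supplies (`IsSubordinator.ae_exists_gt`). -/

/-! ### Laws of limits and of adapted sequences -/

/-- If two sequences of random variables have the same laws and converge almost everywhere, then
their limits have the same law. -/
theorem map_eq_of_tendsto_ae {Ω F : Type*} [MeasurableSpace Ω] {P : Measure Ω} [IsFiniteMeasure P]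
    [TopologicalSpace F] [MeasurableSpace F] [BorelSpace F] [HasOuterApproxClosed F]
    [TopologicalSpace.PseudoMetrizableSpace F]
    {X Y : ℕ → Ω → F} {X' Y' : Ω → F} (hX : ∀ n, AEMeasurable (X n) P)
    (hY : ∀ n, AEMeasurable (Y n) P)
    (hlaw : ∀ n, P.map (X n) = P.map (Y n))
    (hXl : ∀ᵐ ω ∂P, Tendsto (fun n => X n ω) atTop (𝓝 (X' ω)))
    (hYl : ∀ᵐ ω ∂P, Tendsto (fun n => Y n ω) atTop (𝓝 (Y' ω))) :
    P.map X' = P.map Y' := by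
  have hX' : AEMeasurable X' P := aemeasurable_of_tendsto_metrizable_ae' hX hXl
  have hY' : AEMeasurable Y' P := aemeasurable_of_tendsto_metrizable_ae' hY hYl
  refine ext_of_forall_integral_eq_of_IsFiniteMeasure fun f => ?_
  have hf : ∀ μ : Measure F, AEStronglyMeasurable f μ :=
    fun μ => f.continuous.measurable.stronglyMeasurable.aestronglyMeasurable
  rw [integral_map hX' (hf _), integral_map hY' (hf _)]
  have key : ∀ {Z : ℕ → Ω → F} {Z' : Ω → F}, (∀ n, AEMeasurable (Z n) P) →
      (∀ᵐ ω ∂P, Tendsto (fun n => Z n ω) atTop (𝓝 (Z' ω))) →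
      Tendsto (fun n => ∫ ω, f (Z n ω) ∂P) atTop (𝓝 (∫ ω, f (Z' ω) ∂P)) := by
    intro Z Z' hZ hZl
    refine tendsto_integral_of_dominated_convergence (fun _ => ‖f‖) (fun n => ?_)
      (integrable_const _) (fun n => ae_of_all _ fun ω => f.norm_coe_le_norm _) ?_
    · exact (f.continuous.measurable.comp_aemeasurable (hZ n)).aestronglyMeasurable
    · filter_upwards [hZl] with ω hω
      exact (f.continuous.tendsto _).comp hω
  refine tendsto_nhds_unique (key hX hXl) ?_
  convert key hY hYl using 2 with n
  rw [← integral_map (hX n) (hf _), ← integral_map (hY n) (hf _), hlaw n]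

/-- The sequence `η 0, …, η (N - 1), 0, 0, …`. -/
def seqPrefix {Ω E : Type*} [Zero E] (η : ℕ → Ω → E) : ℕ → Ω → ℕ → E
  | 0, _ => 0
  | N + 1, ω => Function.update (seqPrefix η N ω) N (η N ω)

theorem seqPrefix_apply {Ω E : Type*} [Zero E] (η : ℕ → Ω → E) {N j : ℕ} (h : j < N) (ω : Ω) :
    seqPrefix η N ω j = η j ω := by
  induction N with
  | zero => omega
  | succ N ih =>
    rw [seqPrefix]
    rcases Nat.lt_succ_iff_lt_or_eq.1 h with h | rfl
    · rw [Function.update_of_ne h.ne, ih h]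
    · simp

theorem measurable_seqPrefix {Ω E : Type*} [Zero E] [MeasurableSpace E] {𝓕 : ℕ → MeasurableSpace Ω}
    (hmono : Monotone 𝓕) {η : ℕ → Ω → E} (hη : ∀ j, Measurable[𝓕 (j + 1)] (η j)) (N : ℕ) :
    Measurable[𝓕 N] (seqPrefix η N) := by
  induction N with
  | zero => exact measurable_const
  | succ N ih =>
    exact (measurable_update' (a := N)).comp ((ih.mono (hmono N.le_succ) le_rfl).prodMk (hη N))

/-- The law of an adapted sequence whose terms are independent of the past is determined by the
laws of the terms. -/
theorem map_seqPrefix_eq {Ω E : Type*} [Zero E] [MeasurableSpace E] [m : MeasurableSpace Ω]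
    {P : Measure Ω} [IsProbabilityMeasure P] {𝓕 : ℕ → MeasurableSpace Ω} (hmono : Monotone 𝓕)
    (hle : ∀ n, 𝓕 n ≤ m) {η ξ : ℕ → Ω → E} (hη : ∀ j, Measurable[𝓕 (j + 1)] (η j))
    (hξ : ∀ j, Measurable[𝓕 (j + 1)] (ξ j))
    (hηi : ∀ j, Indep (𝓕 j) (MeasurableSpace.comap (η j) inferInstance) P)
    (hξi : ∀ j, Indep (𝓕 j) (MeasurableSpace.comap (ξ j) inferInstance) P)
    (hlaw : ∀ j, P.map (η j) = P.map (ξ j)) (N : ℕ) :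
    P.map (seqPrefix η N) = P.map (seqPrefix ξ N) := by
  have step : ∀ {ζ : ℕ → Ω → E}, (∀ j, Measurable[𝓕 (j + 1)] (ζ j)) →
      (∀ j, Indep (𝓕 j) (MeasurableSpace.comap (ζ j) inferInstance) P) → ∀ N,
      P.map (seqPrefix ζ (N + 1)) = ((P.map (seqPrefix ζ N)).prod (P.map (ζ N))).map
        (fun p => Function.update p.1 N p.2) := by
    intro ζ hζ hζi N
    have h1 : Measurable (seqPrefix ζ N) := (measurable_seqPrefix hmono hζ N).mono (hle _) le_rfl
    have h2 : Measurable (ζ N) := (hζ N).mono (hle _) le_rfl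
    have hind : IndepFun (seqPrefix ζ N) (ζ N) P := by
      rw [IndepFun_iff_Indep]
      exact indep_of_indep_of_le_left (hζi N) (measurable_seqPrefix hmono hζ N).comap_le
    rw [← (indepFun_iff_map_prod_eq_prod_map_map h1.aemeasurable h2.aemeasurable).1 hind,
      Measure.map_map measurable_update' (h1.prodMk h2)]
    rfl
  induction N with
  | zero => rfl
  | succ N ih => rw [step hη hηi, step hξ hξi, ih, hlaw]

-- As A belongs to the past, s splits into two past events. On each of them the new variable is O ∘
-- ξ or ξ, both independent of the past and with one common law.
open Classical in
theorem measure_inter_ite_preimage {Ω E : Type*} [MeasurableSpace E] {𝓖 : MeasurableSpace Ω}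
    [m : MeasurableSpace Ω] {P : Measure Ω} (hle : 𝓖 ≤ m)
    {ξ : Ω → E} (hξ : Measurable ξ)
    (hi : Indep 𝓖 (MeasurableSpace.comap ξ inferInstance) P) {O : E → E} (hO : Measurable O)
    (hlaw : P.map (fun ω => O (ξ ω)) = P.map ξ) {A : Set Ω} (hA : MeasurableSet[𝓖] A)
    {s : Set Ω} (hs : MeasurableSet[𝓖] s) {D : Set E} (hD : MeasurableSet D) :
    P (s ∩ (fun ω => if ω ∈ A then O (ξ ω) else ξ ω) ⁻¹' D) = P s * P.map ξ D := by
  have e1 : s ∩ (fun ω => if ω ∈ A then O (ξ ω) else ξ ω) ⁻¹' D =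
      ((s ∩ A) ∩ ξ ⁻¹' (O ⁻¹' D)) ∪ ((s \ A) ∩ ξ ⁻¹' D) := by
    ext ω
    by_cases h : ω ∈ A <;> simp [h]
  have h1 := (Indep_iff _ _ _).1 hi (s ∩ A) (ξ ⁻¹' (O ⁻¹' D)) (hs.inter hA) ⟨_, hO hD, rfl⟩
  have h2 := (Indep_iff _ _ _).1 hi (s \ A) (ξ ⁻¹' D) (hs.diff hA) ⟨_, hD, rfl⟩
  have h3 : P (ξ ⁻¹' (O ⁻¹' D)) = P (ξ ⁻¹' D) := by
    have := congrArg (fun μ => μ D) hlaw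
    rwa [Measure.map_apply (by fun_prop) hD, Measure.map_apply hξ hD] at this
  rw [e1, measure_union, h1, h2, h3, ← add_mul, measure_inter_add_sdiff _ (hle _ hA),
    Measure.map_apply hξ hD]
  · refine Set.disjoint_left.2 fun ω h h' => h'.1.2 h.1.2
  · exact ((hle _ hs).diff (hle _ hA)).inter (hξ hD)

open Classical in
theorem measurable_ite_mem {Ω E : Type*} [MeasurableSpace E] [MeasurableSpace Ω] {ξ : Ω → E}
    (hξ : Measurable ξ) {O : E → E} (hO : Measurable O) {A : Set Ω} (hA : MeasurableSet A) :
    Measurable (fun ω => if ω ∈ A then O (ξ ω) else ξ ω) :=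
  Measurable.ite hA (hO.comp hξ) hξ

open Classical in
theorem map_ite_eq {Ω E : Type*} [MeasurableSpace E] {𝓖 : MeasurableSpace Ω}
    [m : MeasurableSpace Ω] {P : Measure Ω} [IsProbabilityMeasure P] (hle : 𝓖 ≤ m)
    {ξ : Ω → E} (hξ : Measurable ξ)
    (hi : Indep 𝓖 (MeasurableSpace.comap ξ inferInstance) P) {O : E → E} (hO : Measurable O)
    (hlaw : P.map (fun ω => O (ξ ω)) = P.map ξ) {A : Set Ω} (hA : MeasurableSet[𝓖] A) :
    P.map (fun ω => if ω ∈ A then O (ξ ω) else ξ ω) = P.map ξ := by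
  ext D hD
  have := measure_inter_ite_preimage hle hξ hi hO hlaw hA MeasurableSet.univ hD
  rwa [Set.univ_inter, measure_univ, one_mul,
    ← Measure.map_apply (measurable_ite_mem hξ hO (hle _ hA)) hD] at this

open Classical in
theorem indep_ite {Ω E : Type*} [MeasurableSpace E] {𝓖 : MeasurableSpace Ω}
    [m : MeasurableSpace Ω] {P : Measure Ω} [IsProbabilityMeasure P] (hle : 𝓖 ≤ m)
    {ξ : Ω → E} (hξ : Measurable ξ)
    (hi : Indep 𝓖 (MeasurableSpace.comap ξ inferInstance) P) {O : E → E} (hO : Measurable O)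
    (hlaw : P.map (fun ω => O (ξ ω)) = P.map ξ) {A : Set Ω} (hA : MeasurableSet[𝓖] A) :
    Indep 𝓖 (MeasurableSpace.comap (fun ω => if ω ∈ A then O (ξ ω) else ξ ω) inferInstance) P := by
  rw [Indep_iff]
  rintro s _ hs ⟨D, hD, rfl⟩
  rw [measure_inter_ite_preimage hle hξ hi hO hlaw hA hs hD, ← map_ite_eq hle hξ hi hO hlaw hA,
    Measure.map_apply (measurable_ite_mem hξ hO (hle _ hA)) hD]

/-! ### Independence of increments from the past -/

/-- The sigma-algebra generated by the process up to time `s`. -/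
abbrev pastSigma {Ω E : Type*} [MeasurableSpace E] (X : ℝ≥0 → Ω → E) (s : ℝ≥0) : MeasurableSpace Ω :=
  MeasurableSpace.comap (fun ω (u : Set.Iic s) => X u ω) inferInstance

theorem measurable_pastSigma {Ω E : Type*} [MeasurableSpace E] (X : ℝ≥0 → Ω → E) {s u : ℝ≥0}
    (h : u ≤ s) : Measurable[pastSigma X s] (X u) :=
  (measurable_pi_apply (⟨u, h⟩ : Set.Iic s)).comp
    (comap_measurable (fun ω (u : Set.Iic s) => X u ω))

theorem pastSigma_le {Ω E : Type*} [MeasurableSpace E] [m : MeasurableSpace Ω] {X : ℝ≥0 → Ω → E}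
    (hX : ∀ t, Measurable (X t)) (s : ℝ≥0) : pastSigma X s ≤ m :=
  (measurable_pi_lambda _ fun u : Set.Iic s => hX u).comap_le

theorem pastSigma_mono {Ω E : Type*} [MeasurableSpace E] (X : ℝ≥0 → Ω → E) :
    Monotone (pastSigma X) := fun _ t h =>
  (@measurable_pi_lambda _ _ _ (pastSigma X t) _ _
    fun u => measurable_pastSigma X (u.2.trans h)).comap_le

/-- The increments of a process with independent increments are independent of the past. -/
theorem indep_pastSigma_increment {Ω E : Type*} [NormedAddCommGroup E] [MeasurableSpace E]
    [BorelSpace E] [SecondCountableTopology E]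
    [MeasurableSpace Ω] {P : Measure Ω} [IsProbabilityMeasure P] {X : ℝ≥0 → Ω → E}
    (hX : ∀ t, Measurable (X t)) (h0 : ∀ᵐ ω ∂P, X 0 ω = 0) (hi : HasIndepIncrements X P)
    {s t : ℝ≥0} (hst : s ≤ t) :
    Indep (pastSigma X s) (MeasurableSpace.comap (fun ω => X t ω - X s ω) inferInstance) P := by
  change Indep (MeasurableSpace.comap (fun ω (u : Set.Iic s) => X u ω) _) _ P
  rw [← IndepFun_iff_Indep]
  refine IndepFun.process_indepFun (fun u => hX u) ((hX t).sub (hX s)) fun I => ?_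
  let J : Finset ℝ≥0 := I.map (Function.Embedding.subtype _)
  have hJ : ∀ {u}, u ∈ J → u ≤ s := by
    intro u hu
    obtain ⟨v, -, rfl⟩ := Finset.mem_map.1 hu
    exact v.2
  -- The chain runs through 0, the points of J in increasing order, s, and then t forever. Hence
  -- increment number `J.card + 1` is `X t - X s`.
  let τ : ℕ → ℝ≥0
    | 0 => 0
    | i + 1 => if h : i < J.card then J.orderEmbOfFin rfl ⟨i, h⟩ else if i = J.card then s else t
  have hτ : Monotone τ := by
    refine monotone_nat_of_le_succ fun i => ?_
    rcases i with _ | i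
    · exact zero_le
    · simp only [τ]
      split_ifs with h1 h2 h3 h4 h5 <;> first | omega | skip
      · exact (J.orderEmbOfFin rfl).monotone (by simp)
      · exact hJ (J.orderEmbOfFin_mem rfl _)
      · exact le_rfl
  have hind := (hi.nat hτ).indepFun_finset (Finset.range (J.card + 1)) {J.card + 1} (by simp)
    (fun i => (hX _).sub (hX _))
  have hmem : ∀ u : I, (u.1.1 : ℝ≥0) ∈ J := fun u =>
    Finset.mem_map_of_mem (Function.Embedding.subtype _) u.2
  let idx : I → ℕ := fun u => ((J.orderIsoOfFin rfl).symm ⟨u.1.1, hmem u⟩ : Fin J.card)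
  have hidx : ∀ u, idx u < J.card := fun u => Fin.is_lt _
  have hτidx : ∀ u, τ (idx u + 1) = u.1.1 := by
    intro u
    simp only [τ, dif_pos (hidx u)]
    change J.orderEmbOfFin rfl ((J.orderIsoOfFin rfl).symm ⟨u.1.1, hmem u⟩) = _
    rw [← Finset.coe_orderIsoOfFin_apply, OrderIso.apply_symm_apply]
  -- Since X starts at 0, its values at the past times are partial sums of the earlier increments.
  let φ : (Finset.range (J.card + 1) → E) → I → E := fun z u =>
    ∑ j : Finset.range (J.card + 1), if j.1 < idx u + 1 then z j else 0
  have hφ : Measurable φ := by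
    refine measurable_pi_lambda _ fun u => Finset.measurable_sum _ fun j _ => ?_
    split_ifs
    · exact measurable_pi_apply _
    · exact measurable_const
  have hψ : Measurable (fun z : ({J.card + 1} : Finset ℕ) → E => z ⟨J.card + 1, by simp⟩) :=
    measurable_pi_apply _
  refine (hind.comp hφ hψ).congr ?_ ?_
  · filter_upwards [h0] with ω hω
    ext u
    simp only [φ, Function.comp_apply]
    rw [Finset.sum_coe_sort (Finset.range (J.card + 1))
      (fun j => if j < idx u + 1 then X (τ (j + 1)) ω - X (τ j) ω else 0), ← Finset.sum_filter]
    have : (Finset.range (J.card + 1)).filter (fun j => j < idx u + 1) =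
        Finset.range (idx u + 1) := by
      ext j
      have := hidx u
      simp only [Finset.mem_filter, Finset.mem_range]
      omega
    rw [this, Finset.sum_range_sub (fun j => X (τ j) ω), hτidx]
    simp [τ, hω]
  · refine ae_of_all _ fun ω => ?_
    simp [τ]

/-! ### Evaluation of paths at random times -/

/-- Evaluation of a path at a time, as the limit along the grids `ℕ / n`; it is jointly
measurable. -/
noncomputable def evalLim {E : Type*} [TopologicalSpace E] [Nonempty E] (b : ℝ≥0 → E) (u : ℝ≥0) : E :=
  limUnder atTop fun n : ℕ => b ((⌊u * n⌋₊ : ℝ≥0) / n)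

theorem tendsto_floor_div (u : ℝ≥0) :
    Tendsto (fun n : ℕ => (⌊u * n⌋₊ : ℝ≥0) / n) atTop (𝓝 u) := by
  rw [← NNReal.tendsto_coe]
  have := (tendsto_nat_floor_mul_div_atTop u.2).comp tendsto_natCast_atTop_atTop
  refine this.congr fun n => ?_
  simp only [Function.comp_apply, NNReal.coe_div, NNReal.coe_natCast]
  congr 2

theorem tendsto_ceil_div (u : ℝ≥0) :
    Tendsto (fun n : ℕ => (⌈u * n⌉₊ : ℝ≥0) / n) atTop (𝓝 u) := by
  rw [← NNReal.tendsto_coe]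
  have := (tendsto_nat_ceil_mul_div_atTop u.2).comp tendsto_natCast_atTop_atTop
  refine this.congr fun n => ?_
  simp only [Function.comp_apply, NNReal.coe_div, NNReal.coe_natCast]
  congr 2

theorem evalLim_eq {E : Type*} [TopologicalSpace E] [T2Space E] [Nonempty E] {b : ℝ≥0 → E}
    (hb : Continuous b) (u : ℝ≥0) : evalLim b u = b u :=
  ((hb.tendsto u).comp (tendsto_floor_div u)).limUnder_eq

/-- Each approximant depends on the time only through an integer, and countability of the integers
makes it jointly measurable. -/
theorem measurable_evalLim {E : Type*} [NormedAddCommGroup E] [CompleteSpace E]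
    [SecondCountableTopology E] [MeasurableSpace E] [BorelSpace E] :
    Measurable (fun p : (ℝ≥0 → E) × ℝ≥0 => evalLim p.1 p.2) := by
  refine (StronglyMeasurable.limUnder fun n => ?_).measurable
  have h : Measurable (fun p : (ℝ≥0 → E) × ℕ => p.1 ((p.2 : ℝ≥0) / n)) :=
    measurable_from_prod_countable_left fun k => measurable_pi_apply ((k : ℝ≥0) / n)
  have h2 : Measurable (fun p : (ℝ≥0 → E) × ℝ≥0 => (p.1, ⌊p.2 * n⌋₊)) :=
    measurable_fst.prodMk (Nat.measurable_floor.comp (measurable_snd.mul_const _))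
  exact (h.comp h2).stronglyMeasurable

/-! ### Reflection and hitting times of a single continuous path -/

section Geometry

variable {E : Type*} [NormedAddCommGroup E] [InnerProductSpace ℝ E]

/-- The signed (unnormalized) distance of `z` to the plane `midPlane x y`, positive on the side
of `x`. -/
noncomputable def planeSide (x y z : E) : ℝ := ⟪z - (2⁻¹ : ℝ) • (x + y), x - y⟫

theorem continuous_planeSide (x y : E) : Continuous (planeSide x y) := by
  unfold planeSide
  fun_prop

theorem mem_midPlane_iff {x y z : E} : z ∈ midPlane x y ↔ planeSide x y z = 0 := by
  have h1 : ‖x - z‖ ^ 2 - ‖y - z‖ ^ 2 = -2 * planeSide x y z := by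
    rw [norm_sub_sq_real, norm_sub_sq_real, planeSide]
    simp only [inner_sub_left, inner_sub_right, inner_smul_left, inner_add_left,
      real_inner_self_eq_norm_sq, real_inner_comm x z, real_inner_comm y z, real_inner_comm x y]
    simp only [conj_trivial]
    ring
  change ‖x - z‖ = ‖y - z‖ ↔ _
  rw [← sq_eq_sq₀ (norm_nonneg _) (norm_nonneg _), ← sub_eq_zero, h1]
  simp

theorem planeSide_add_left (x y b : E) : planeSide x y (x + b) = ⟪b, x - y⟫ + ‖x - y‖ ^ 2 / 2 := by
  rw [planeSide, show x + b - (2⁻¹ : ℝ) • (x + y) = b + (2⁻¹ : ℝ) • (x - y) by module,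
    inner_add_left, inner_smul_left, real_inner_self_eq_norm_sq]
  simp only [conj_trivial]
  ring

theorem planeSide_add_right (x y b : E) :
    planeSide x y (y + b) = ⟪b, x - y⟫ - ‖x - y‖ ^ 2 / 2 := by
  rw [planeSide, show y + b - (2⁻¹ : ℝ) • (x + y) = b - (2⁻¹ : ℝ) • (x - y) by module,
    inner_sub_left, inner_smul_left, real_inner_self_eq_norm_sq]
  simp only [conj_trivial]
  ring

theorem planeSide_left_pos {x y : E} (h : x ≠ y) : 0 < planeSide x y x := by
  have := planeSide_add_left x y 0
  have h2 : 0 < ‖x - y‖ := norm_pos_iff.2 (sub_ne_zero.2 h)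
  simp only [add_zero, inner_zero_left, zero_add] at this
  rw [this]
  positivity

theorem planeReflection_eq (x y z : E) : planeReflection x y z =
    z - (2 * planeSide x y z / ‖x - y‖ ^ 2) • (x - y) := rfl

theorem planeSide_planeReflection {x y : E} (h : x ≠ y) (z : E) :
    planeSide x y (planeReflection x y z) = - planeSide x y z := by
  have h2 : ‖x - y‖ ≠ 0 := norm_ne_zero_iff.2 (sub_ne_zero.2 h)
  rw [planeReflection_eq, planeSide, sub_right_comm, inner_sub_left, inner_smul_left,
    real_inner_self_eq_norm_sq, ← planeSide]
  simp only [conj_trivial]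
  field_simp
  ring

theorem planeReflection_of_mem {x y z : E} (h : planeSide x y z = 0) :
    planeReflection x y z = z := by
  simp [planeReflection_eq, h]

/-- Reflecting a path from x thus amounts to starting at y and applying one linear isometry to the
increments. -/
theorem planeReflection_eq_add_reflection {x y : E} (h : x ≠ y) (z : E) :
    planeReflection x y z = y + (ℝ ∙ (x - y))ᗮ.reflection (z - x) := by
  have h2 : ‖x - y‖ ≠ 0 := norm_ne_zero_iff.2 (sub_ne_zero.2 h)
  have h3 := planeSide_add_left x y (z - x)
  rw [add_sub_cancel] at h3
  rw [planeReflection_eq, h3, Submodule.reflection_orthogonal_apply,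
    Submodule.reflection_singleton_apply, real_inner_comm]
  simp only [RCLike.ofReal_real_eq_id, id]
  have : 2 * (⟪x - y, z - x⟫ + ‖x - y‖ ^ 2 / 2) / ‖x - y‖ ^ 2 =
      2 * (⟪x - y, z - x⟫ / ‖x - y‖ ^ 2) + 1 := by
    field_simp
  rw [this]
  module

theorem measurable_planeReflection [MeasurableSpace E] [BorelSpace E] (x y : E) :
    Measurable (planeReflection x y) := by
  have := continuous_planeSide x y
  have h : Continuous fun z => z - (2 * planeSide x y z / ‖x - y‖ ^ 2) • (x - y) := by fun_prop
  exact h.measurable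

/-- The path `b` stays on the side of `x` of the plane `midPlane x y` up to time `s`, expressed
through countably many times. -/
def StaysOnSide (x y : E) (b : ℝ≥0 → E) (s : ℝ≥0) : Prop :=
  ∃ k : ℕ, ∀ n : ℕ, 1 / ((k : ℝ) + 1) ≤
    planeSide x y (b (min (TopologicalSpace.denseSeq ℝ≥0 n) s))

/-- Only weak inequalities pass from a dense set of times to its closure. Hence the uniform bound
1/(k+1), which exists because a positive continuous function on [0, s] has a positive minimum. -/
theorem staysOnSide_iff {x y : E} {b : ℝ≥0 → E} (hb : Continuous b) {s : ℝ≥0} :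
    StaysOnSide x y b s ↔ ∀ u ≤ s, 0 < planeSide x y (b u) := by
  have hc : Continuous fun u => planeSide x y (b u) := (continuous_planeSide x y).comp hb
  constructor
  · rintro ⟨k, hk⟩ u hu
    have hcl : IsClosed {u : ℝ≥0 | 1 / ((k : ℝ) + 1) ≤ planeSide x y (b (min u s))} :=
      isClosed_le continuous_const (hc.comp (continuous_id.min continuous_const))
    have := hcl.closure_subset_iff.2 (Set.range_subset_iff.2 hk)
      ((TopologicalSpace.denseRange_denseSeq ℝ≥0) u)
    simp only [Set.mem_ofPred_eq, min_eq_left hu] at this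
    exact lt_of_lt_of_le (by positivity) this
  · intro h
    obtain ⟨u, hu, hmin⟩ := (isCompact_Icc (a := (0 : ℝ≥0)) (b := s)).exists_isMinOn
      (Set.nonempty_Icc.2 zero_le) hc.continuousOn
    obtain ⟨k, hk⟩ := exists_nat_one_div_lt (h u hu.2)
    exact ⟨k, fun n => hk.le.trans (hmin ⟨zero_le, min_le_right _ _⟩)⟩

variable {Ω : Type*} {X : ℝ≥0 → Ω → E} {ω : Ω} {x y : E}

/-- A path that leaves the side of x crosses the plane by the intermediate value theorem.
Conversely, positivity at s persists on some [s, l), so the infimum is at least l, hence strictly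
larger than s. -/
theorem lt_planeHittingTime_iff (hxy : x ≠ y) (hc : Continuous fun t => X t ω) (h0 : X 0 ω = x)
    (s : ℝ≥0) :
    (s : ℝ≥0∞) < planeHittingTime x y X ω ↔ ∀ u ≤ s, 0 < planeSide x y (X u ω) := by
  have hg : Continuous fun u => planeSide x y (X u ω) := (continuous_planeSide x y).comp hc
  have hg0 : 0 < planeSide x y (X 0 ω) := by
    rw [h0]; exact planeSide_left_pos hxy
  constructor
  · intro hs u hu
    by_contra! hneg
    obtain ⟨v, hv, hv0⟩ := intermediate_value_Icc' (zero_le (a := u)) hg.continuousOn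
      ⟨hneg, hg0.le⟩
    have hv1 : 0 < v := by
      rcases eq_or_ne v 0 with rfl | h
      · simp only at hv0
        exact absurd hv0 hg0.ne'
      · exact pos_iff_ne_zero.2 h
    have : planeHittingTime x y X ω ≤ v := iInf₂_le v ⟨hv1, mem_midPlane_iff.2 hv0⟩
    exact absurd (hs.trans_le this) (not_lt.2 (by exact_mod_cast hv.2.trans hu))
  · intro h
    have hev : ∀ᶠ u in 𝓝 s, 0 < planeSide x y (X u ω) :=
      hg.continuousAt.eventually (lt_mem_nhds (h s le_rfl))
    obtain ⟨l, hl, hl'⟩ := exists_Ico_subset_of_mem_nhds hev (exists_gt s)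
    refine lt_of_lt_of_le (b := (l : ℝ≥0∞)) (by exact_mod_cast hl) ?_
    refine le_iInf₂ fun u hu => ?_
    by_contra! hlt
    have hlt' : u < l := by exact_mod_cast hlt
    have hpos : 0 < planeSide x y (X u ω) := by
      rcases le_total u s with hus | hus
      · exact h u hus
      · exact hl' ⟨hus, hlt'⟩
    exact hpos.ne' (mem_midPlane_iff.1 hu.2)

theorem planeSide_hitting_eq_zero (hxy : x ≠ y) (hc : Continuous fun t => X t ω) (h0 : X 0 ω = x)
    {τ : ℝ≥0} (hτ : planeHittingTime x y X ω = τ) : planeSide x y (X τ ω) = 0 := by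
  have hg : Continuous fun u => planeSide x y (X u ω) := (continuous_planeSide x y).comp hc
  have hlt : ∀ u < τ, 0 < planeSide x y (X u ω) := fun u hu =>
    (lt_planeHittingTime_iff hxy hc h0 u).1 (by rw [hτ]; exact_mod_cast hu) u le_rfl
  have hle : planeSide x y (X τ ω) ≤ 0 := by
    by_contra! hpos
    have := (lt_planeHittingTime_iff hxy hc h0 τ).2 fun u hu => by
      rcases hu.lt_or_eq with h | rfl
      · exact hlt u h
      · exact hpos
    exact absurd this (by simp [hτ])
  have hg0 : 0 < planeSide x y (X 0 ω) := by
    rw [h0]; exact planeSide_left_pos hxy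
  obtain ⟨v, hv, hv0⟩ := intermediate_value_Icc' (zero_le (a := τ)) hg.continuousOn ⟨hle, hg0.le⟩
  rcases hv.2.lt_or_eq with h | rfl
  · exact absurd hv0 (hlt v h).ne'
  · exact hv0

-- Both sums telescope. When the increments are mapped by O exactly up to index K, the only
-- deviation is O minus the identity on the displacement at `min i K`.
open Classical in
theorem sum_ite_map_sub {E : Type*} [AddCommGroup E] {f : ℕ → E} {O : E →+ E} {a : ℕ → Prop} {i K : ℕ}
    (h : ∀ j < i, a j ↔ j < K) :
    ∑ j ∈ Finset.range i, (if a j then O (f (j + 1) - f j) else f (j + 1) - f j) =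
      f i - f 0 + (O (f (min i K) - f 0) - (f (min i K) - f 0)) := by
  induction i with
  | zero => simp
  | succ i ih =>
    rw [Finset.sum_range_succ, ih fun j hj => h j (hj.trans i.lt_succ_self)]
    have hi := h i i.lt_succ_self
    by_cases hK : i < K
    · rw [if_pos (hi.2 hK), min_eq_left hK.le, min_eq_left hK]
      simp only [map_sub]
      abel
    · rw [if_neg (mt hi.1 hK), min_eq_right (by omega), min_eq_right (by omega)]
      abel

/-- Reflecting the increments over a grid up to the hitting time approximates the reflected
process. -/
theorem tendsto_reflectedProcess (hxy : x ≠ y) (hc : Continuous fun t => X t ω) (h0 : X 0 ω = x)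
    (t : ℝ≥0) [∀ (n j : ℕ), Decidable ((((j : ℝ≥0) / n : ℝ≥0) : ℝ≥0∞) < planeHittingTime x y X ω)] :
    Tendsto (fun n : ℕ => y + ∑ j ∈ Finset.range ⌊t * n⌋₊,
      if (((j : ℝ≥0) / n : ℝ≥0) : ℝ≥0∞) < planeHittingTime x y X ω then
        (ℝ ∙ (x - y))ᗮ.reflection (X (((j + 1 : ℕ) : ℝ≥0) / n) ω - X ((j : ℝ≥0) / n) ω)
      else X (((j + 1 : ℕ) : ℝ≥0) / n) ω - X ((j : ℝ≥0) / n) ω) atTop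
      (𝓝 (reflectedProcess x y X t ω)) := by
  set O := (ℝ ∙ (x - y))ᗮ.reflection with hO
  let O' : E →+ E := O.toLinearEquiv.toLinearMap.toAddMonoidHom
  have hO' : ∀ z, O' z = O z := fun _ => rfl
  have hOc : Continuous O := O.continuous
  have key : ∀ (n : ℕ) (K : ℕ), (∀ j < ⌊t * n⌋₊,
      (((j : ℝ≥0) / n : ℝ≥0) : ℝ≥0∞) < planeHittingTime x y X ω ↔ j < K) →
      (∑ j ∈ Finset.range ⌊t * n⌋₊,
      if (((j : ℝ≥0) / n : ℝ≥0) : ℝ≥0∞) < planeHittingTime x y X ω then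
        O (X (((j + 1 : ℕ) : ℝ≥0) / n) ω - X ((j : ℝ≥0) / n) ω)
      else X (((j + 1 : ℕ) : ℝ≥0) / n) ω - X ((j : ℝ≥0) / n) ω) =
      X ((⌊t * n⌋₊ : ℝ≥0) / n) ω - x +
        (O (X (min ((⌊t * n⌋₊ : ℝ≥0) / n) ((K : ℝ≥0) / n)) ω - x) -
        (X (min ((⌊t * n⌋₊ : ℝ≥0) / n) ((K : ℝ≥0) / n)) ω - x)) := by
    intro n K hK
    have := sum_ite_map_sub (f := fun j : ℕ => X ((j : ℝ≥0) / n) ω) (O := O') hK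
    have e : (((min ⌊t * n⌋₊ K : ℕ) : ℝ≥0) / n : ℝ≥0) =
        min ((⌊t * n⌋₊ : ℝ≥0) / n) ((K : ℝ≥0) / n) := by
      rw [Nat.cast_min]
      exact (Monotone.map_min (f := fun z : ℝ≥0 => z / n)
        (fun a b h => div_le_div_of_nonneg_right h zero_le)).symm ▸ rfl
    simp only [e, hO', Nat.cast_zero, zero_div, h0] at this
    convert this
  have hfl := tendsto_floor_div t
  have hXfl := (hc.tendsto t).comp hfl
  by_cases ht : (t : ℝ≥0∞) < planeHittingTime x y X ω
  · rw [reflectedProcess, if_pos ht, planeReflection_eq_add_reflection hxy]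
    refine Tendsto.const_add _ ?_
    refine Tendsto.congr (f₁ := fun n : ℕ => O (X ((⌊t * n⌋₊ : ℝ≥0) / n) ω - x)) (fun n => ?_)
      ((hOc.tendsto _).comp (hXfl.sub_const x))
    rw [key n ⌊t * n⌋₊, min_self]
    · abel
    -- Every grid point below t precedes the hitting time, so all increments are reflected.
    · intro j hj
      refine iff_of_true (lt_of_le_of_lt ?_ ht) hj
      rcases Nat.eq_zero_or_pos n with rfl | hn
      · simp
      have : (j : ℝ≥0) ≤ t * n := (Nat.le_floor_iff zero_le).1 hj.le
      have : (j : ℝ≥0) / n ≤ t := (div_le_iff₀ (by exact_mod_cast hn)).2 this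
      exact_mod_cast this
  · rw [reflectedProcess, if_neg ht]
    obtain ⟨τ, hτ⟩ := WithTop.ne_top_iff_exists.1 (ne_top_of_le_ne_top ENNReal.coe_ne_top
      (not_lt.1 ht))
    change (τ : ℝ≥0∞) = _ at hτ
    have hτt : τ ≤ t := by rw [← hτ] at ht; exact_mod_cast not_lt.1 ht
    have hside := planeSide_hitting_eq_zero hxy hc h0 hτ.symm
    have hfix := planeReflection_eq_add_reflection hxy (X τ ω)
    rw [planeReflection_of_mem hside, ← hO] at hfix
    -- The switch occurs at K = ⌈τ n⌉, because j / n < τ is equivalent to j < ⌈τ n⌉; its grid time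
    -- tends to τ.
    have hm : Tendsto (fun n : ℕ => min ((⌊t * n⌋₊ : ℝ≥0) / n) ((⌈τ * n⌉₊ : ℝ≥0) / n)) atTop
        (𝓝 τ) := by
      have := hfl.min (tendsto_ceil_div τ)
      rwa [min_eq_right hτt] at this
    have hXm := ((hc.tendsto τ).comp hm).sub_const x
    have hlim : Tendsto (fun n : ℕ => y + (X ((⌊t * n⌋₊ : ℝ≥0) / n) ω - x +
        (O (X (min ((⌊t * n⌋₊ : ℝ≥0) / n) ((⌈τ * n⌉₊ : ℝ≥0) / n)) ω - x) -
        (X (min ((⌊t * n⌋₊ : ℝ≥0) / n) ((⌈τ * n⌉₊ : ℝ≥0) / n)) ω - x)))) atTop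
        (𝓝 (y + (X t ω - x + (O (X τ ω - x) - (X τ ω - x))))) :=
      ((hXfl.sub_const x).add (((hOc.tendsto _).comp hXm).sub hXm)).const_add y
    -- The path is on the plane at τ, so reflection fixes `X τ ω`; this cancels the shift from x to
    -- y.
    have e : y + (X t ω - x + (O (X τ ω - x) - (X τ ω - x))) = X t ω := by
      have : O (X τ ω - x) = X τ ω - y := by rw [eq_sub_iff_add_eq', ← hfix]
      rw [this]
      abel
    rw [e] at hlim
    refine hlim.congr' ?_
    filter_upwards [eventually_ge_atTop 1] with n hn
    rw [key n ⌈τ * n⌉₊]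
    intro j _
    rw [← hτ, Nat.lt_ceil, ENNReal.coe_lt_coe, div_lt_iff₀ (by exact_mod_cast hn)]

end Geometry

theorem measurableSet_staysOnSide {E Ω : Type*} [NormedAddCommGroup E] [InnerProductSpace ℝ E]
    [MeasurableSpace E] [BorelSpace E] [MeasurableSpace Ω] (x y : E) {X : ℝ≥0 → Ω → E} {s : ℝ≥0}
    (hX : ∀ u ≤ s, Measurable (X u)) :
    MeasurableSet {ω | StaysOnSide x y (fun u => X u ω) s} := by
  have : {ω | StaysOnSide x y (fun u => X u ω) s} = ⋃ k : ℕ, ⋂ n : ℕ,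
      {ω | 1 / ((k : ℝ) + 1) ≤ planeSide x y (X (min (TopologicalSpace.denseSeq ℝ≥0 n) s) ω)} := by
    ext ω
    simp [StaysOnSide]
  rw [this]
  refine MeasurableSet.iUnion fun k => MeasurableSet.iInter fun n => ?_
  exact measurableSet_le measurable_const
    ((continuous_planeSide x y).measurable.comp (hX _ (min_le_right _ _)))

open Classical in
/-- The reflection of a path at `midPlane x y` as a measurable functional of the path. -/
noncomputable def reflectPath {E : Type*} [NormedAddCommGroup E] [InnerProductSpace ℝ E]
    (x y : E) (b : ℝ≥0 → E) (t : ℝ≥0) : E :=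
  if StaysOnSide x y b t then planeReflection x y (b t) else b t

theorem measurable_reflectPath {E : Type*} [NormedAddCommGroup E] [InnerProductSpace ℝ E]
    [MeasurableSpace E] [BorelSpace E] (x y : E) : Measurable (reflectPath x y) := by
  refine measurable_pi_lambda _ fun t => ?_
  refine Measurable.ite ?_ ((measurable_planeReflection x y).comp (measurable_pi_apply t))
    (measurable_pi_apply t)
  exact measurableSet_staysOnSide x y (X := fun u (b : ℝ≥0 → E) => b u) fun u _ => measurable_pi_apply u

theorem staysOnSide_iff_lt_planeHittingTime {E Ω : Type*} [NormedAddCommGroup E]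
    [InnerProductSpace ℝ E] {X : ℝ≥0 → Ω → E} {ω : Ω} {x y : E} (hxy : x ≠ y)
    (hc : Continuous fun t => X t ω) (h0 : X 0 ω = x) (t : ℝ≥0) :
    StaysOnSide x y (fun u => X u ω) t ↔ (t : ℝ≥0∞) < planeHittingTime x y X ω := by
  rw [staysOnSide_iff hc, lt_planeHittingTime_iff hxy hc h0]

theorem reflectPath_eq {E Ω : Type*} [NormedAddCommGroup E] [InnerProductSpace ℝ E]
    {X : ℝ≥0 → Ω → E} {ω : Ω} {x y : E} (hxy : x ≠ y) (hc : Continuous fun t => X t ω)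
    (h0 : X 0 ω = x) (t : ℝ≥0) :
    reflectPath x y (fun u => X u ω) t = reflectedProcess x y X t ω := by
  unfold reflectPath reflectedProcess
  simp only [staysOnSide_iff_lt_planeHittingTime hxy hc h0]

/-- The branches match at the switching time, when the path is on the plane. Continuity is what
allows `evalLim` to evaluate this process at the clock. -/
theorem continuous_reflectedProcess {E Ω : Type*} [NormedAddCommGroup E] [InnerProductSpace ℝ E]
    {X : ℝ≥0 → Ω → E} {ω : Ω} {x y : E} (hxy : x ≠ y) (hc : Continuous fun t => X t ω)
    (h0 : X 0 ω = x) : Continuous fun t => reflectedProcess x y X t ω := by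
  have hR : Continuous (planeReflection x y) := by
    have := continuous_planeSide x y
    change Continuous fun z => z - (2 * planeSide x y z / ‖x - y‖ ^ 2) • (x - y)
    fun_prop
  unfold reflectedProcess
  refine Continuous.if (fun t ht => ?_) (hR.comp hc) hc
  have hle : (t : ℝ≥0∞) = planeHittingTime x y X ω :=
    frontier_lt_subset_eq ENNReal.continuous_coe continuous_const ht
  exact planeReflection_of_mem (planeSide_hitting_eq_zero hxy hc h0 hle.symm)

/-! ### The reflection principle and its subordinated form -/

section

variable {d : ℕ} {Ω : Type*} [MeasurableSpace Ω] {P : Measure Ω}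
  {B : ℝ≥0 → Ω → EuclideanSpace ℝ (Fin d)} {x y : EuclideanSpace ℝ (Fin d)}

theorem IsBrownianMotion.map_isometry_increment (hB : IsBrownianMotion B P)
    (O : EuclideanSpace ℝ (Fin d) ≃ₗᵢ[ℝ] EuclideanSpace ℝ (Fin d)) (s h : ℝ≥0) :
    P.map (fun ω => O (B (s + h) ω - B s ω)) = P.map (fun ω => B (s + h) ω - B s ω) := by
  have hO : Measurable O := O.continuous.measurable
  have hsm : Measurable fun z : EuclideanSpace ℝ (Fin d) => √(h : ℝ) • z := by fun_prop
  have h1 : P.map (fun ω => O (B (s + h) ω - B s ω)) =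
      (P.map (fun ω => B (s + h) ω - B s ω)).map O := by
    rw [Measure.map_map hO (by exact (hB.measurable _).sub (hB.measurable _))]
    rfl
  rw [h1, (hB.gaussian s h).map_eq, Measure.map_map hO hsm]
  have : (O ∘ fun z => √(h : ℝ) • z) = (fun z => √(h : ℝ) • z) ∘ O := by
    ext1 z
    simp
  rw [this, ← Measure.map_map hsm hO, stdGaussian_map]

-- This is the reflection principle on a grid: whether an increment is reflected is decided by the
-- path up to the left end of its interval.
open Classical in
theorem IsBrownianMotion.map_reflected_sum [IsProbabilityMeasure P]
    (hB : IsBrownianMotion B P)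
    (O : EuclideanSpace ℝ (Fin d) ≃ₗᵢ[ℝ] EuclideanSpace ℝ (Fin d)) (n : ℕ) (I : Finset ℝ≥0) :
    P.map (fun ω (t : I) => y + ∑ j ∈ Finset.range ⌊(t : ℝ≥0) * n⌋₊,
      if StaysOnSide x y (fun u => x + B u ω) ((j : ℝ≥0) / n) then
        O (B (((j + 1 : ℕ) : ℝ≥0) / n) ω - B ((j : ℝ≥0) / n) ω)
      else B (((j + 1 : ℕ) : ℝ≥0) / n) ω - B ((j : ℝ≥0) / n) ω) =
    P.map (fun ω (t : I) => y + ∑ j ∈ Finset.range ⌊(t : ℝ≥0) * n⌋₊,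
      (B (((j + 1 : ℕ) : ℝ≥0) / n) ω - B ((j : ℝ≥0) / n) ω)) := by
  let 𝓕 : ℕ → MeasurableSpace Ω := fun j => pastSigma B ((j : ℝ≥0) / n)
  have hmono' : Monotone fun j : ℕ => (j : ℝ≥0) / n := fun a b h =>
    div_le_div_of_nonneg_right (by exact_mod_cast h) zero_le
  have hmono : Monotone 𝓕 := (pastSigma_mono B).comp hmono'
  have hle : ∀ j, 𝓕 j ≤ _ := fun j => pastSigma_le hB.measurable _
  let ξ : ℕ → Ω → EuclideanSpace ℝ (Fin d) := fun j ω =>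
    B (((j + 1 : ℕ) : ℝ≥0) / n) ω - B ((j : ℝ≥0) / n) ω
  let A : ℕ → Set Ω := fun j => {ω | StaysOnSide x y (fun u => x + B u ω) ((j : ℝ≥0) / n)}
  let η : ℕ → Ω → EuclideanSpace ℝ (Fin d) := fun j ω => if ω ∈ A j then O (ξ j ω) else ξ j ω
  have hOm : Measurable O := O.continuous.measurable
  have hξm : ∀ j, Measurable (ξ j) := fun j => (hB.measurable _).sub (hB.measurable _)
  have hξ : ∀ j, Measurable[𝓕 (j + 1)] (ξ j) := fun j =>
    Measurable.sub (measurable_pastSigma B le_rfl) (measurable_pastSigma B (hmono' j.le_succ))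
  have hA : ∀ j, MeasurableSet[𝓕 j] (A j) := fun j =>
    @measurableSet_staysOnSide _ _ _ _ _ _ (𝓕 j) x y (fun u ω => x + B u ω) _
      fun u hu => Measurable.const_add (measurable_pastSigma B hu) x
  have hη : ∀ j, Measurable[𝓕 (j + 1)] (η j) := fun j =>
    @measurable_ite_mem _ _ _ (𝓕 (j + 1)) _ (hξ j) _ hOm _ (hmono j.le_succ _ (hA j))
  have hξi : ∀ j, Indep (𝓕 j) (MeasurableSpace.comap (ξ j) inferInstance) P := fun j =>
    indep_pastSigma_increment hB.measurable hB.start hB.indep (hmono' j.le_succ)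
  have hO : ∀ j, P.map (fun ω => O (ξ j ω)) = P.map (ξ j) := by
    intro j
    have := hB.map_isometry_increment O ((j : ℝ≥0) / n) (1 / n)
    rwa [← add_div, ← Nat.cast_add_one] at this
  have hηi : ∀ j, Indep (𝓕 j) (MeasurableSpace.comap (η j) inferInstance) P := fun j =>
    indep_ite (hle j) (hξm j) (hξi j) hOm (hO j) (hA j)
  have hlaw : ∀ j, P.map (η j) = P.map (ξ j) := fun j =>
    map_ite_eq (hle j) (hξm j) (hξi j) hOm (hO j) (hA j)
  -- A crude common bound, so that one finite prefix of increments serves all times in I.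
  let N : ℕ := ∑ t ∈ I, (⌊(t : ℝ≥0) * n⌋₊ + 1)
  have hN : ∀ t : I, ⌊(t : ℝ≥0) * n⌋₊ ≤ N := fun t =>
    (Nat.le_succ _).trans (Finset.single_le_sum (f := fun t : ℝ≥0 => ⌊t * n⌋₊ + 1)
      (fun _ _ => Nat.zero_le _) t.2)
  let Ψ : (ℕ → EuclideanSpace ℝ (Fin d)) → I → EuclideanSpace ℝ (Fin d) := fun z t =>
    y + ∑ j ∈ Finset.range ⌊(t : ℝ≥0) * n⌋₊, z j
  have hΨ : Measurable Ψ := measurable_pi_lambda _ fun t =>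
    (Finset.measurable_sum _ fun j _ => measurable_pi_apply j).const_add y
  have main := map_seqPrefix_eq hmono hle hη hξ hηi hξi hlaw N
  have key : ∀ ζ : ℕ → Ω → EuclideanSpace ℝ (Fin d), (∀ j, Measurable[𝓕 (j + 1)] (ζ j)) →
      (P.map (seqPrefix ζ N)).map Ψ = P.map (fun ω (t : I) =>
        y + ∑ j ∈ Finset.range ⌊(t : ℝ≥0) * n⌋₊, ζ j ω) := by
    intro ζ hζ
    rw [Measure.map_map hΨ ((measurable_seqPrefix hmono hζ N).mono (hle _) le_rfl)]
    congr 1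
    ext1 ω
    ext1 t
    simp only [Function.comp_apply, Ψ]
    congr 1
    refine Finset.sum_congr rfl fun j hj => seqPrefix_apply ζ ?_ ω
    exact (Finset.mem_range.1 hj).trans_le (hN t)
  exact (key η hη).symm.trans ((congrArg _ main).trans (key ξ hξ))

/-- The **reflection principle**: a Brownian motion from `x`, reflected at `midPlane x y` until it
hits this plane, is a Brownian motion from `y`. -/
theorem IsBrownianMotion.map_reflectPath [IsProbabilityMeasure P]
    (hB : IsBrownianMotion B P) (hxy : x ≠ y) :
    P.map (fun ω => reflectPath x y (fun u => x + B u ω)) = P.map (fun ω t => y + B t ω) := by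
  classical
  have hBm := hB.measurable
  have hXm : Measurable fun ω (u : ℝ≥0) => x + B u ω :=
    measurable_pi_lambda _ fun u => (hBm u).const_add x
  have hΦ : Measurable fun ω => reflectPath x y (fun u => x + B u ω) :=
    (measurable_reflectPath x y).comp hXm
  refine (map_eq_iff_forall_finset_map_restrict_eq
    (X := fun t ω => reflectPath x y (fun u => x + B u ω) t) (Y := fun t ω => y + B t ω)
    hΦ.aemeasurable
    (measurable_pi_lambda _ fun u => (hBm u).const_add y).aemeasurable).2 fun I => ?_
  let O := (ℝ ∙ (x - y))ᗮ.reflection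
  have hinc : ∀ n j : ℕ, Measurable fun ω =>
      B (((j + 1 : ℕ) : ℝ≥0) / n) ω - B ((j : ℝ≥0) / n) ω := fun n j => (hBm _).sub (hBm _)
  refine map_eq_of_tendsto_ae
    (X := fun n ω (t : I) => y + ∑ j ∈ Finset.range ⌊(t : ℝ≥0) * n⌋₊,
      if StaysOnSide x y (fun u => x + B u ω) ((j : ℝ≥0) / n) then
        O (B (((j + 1 : ℕ) : ℝ≥0) / n) ω - B ((j : ℝ≥0) / n) ω)
      else B (((j + 1 : ℕ) : ℝ≥0) / n) ω - B ((j : ℝ≥0) / n) ω)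
    (Y := fun n ω (t : I) => y + ∑ j ∈ Finset.range ⌊(t : ℝ≥0) * n⌋₊,
      (B (((j + 1 : ℕ) : ℝ≥0) / n) ω - B ((j : ℝ≥0) / n) ω))
    (fun n => ?_) (fun n => ?_) (fun n => hB.map_reflected_sum O n I) ?_ ?_
  · apply Measurable.aemeasurable
    beta_reduce
    rw [measurable_pi_iff]
    intro t
    refine Measurable.const_add ?_ y
    refine Finset.measurable_sum _ fun j _ => ?_
    exact measurable_ite_mem (O := O) (A := {ω | StaysOnSide x y (fun u => x + B u ω) ((j : ℝ≥0) / n)})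
      (hinc n j) O.continuous.measurable (measurableSet_staysOnSide x y fun u _ => (hBm u).const_add x)
  · apply Measurable.aemeasurable
    beta_reduce
    rw [measurable_pi_iff]
    intro t
    refine Measurable.const_add ?_ y
    exact Finset.measurable_sum _ fun j _ => hinc n j
  · filter_upwards [hB.start, hB.continuous] with ω h0 hc
    have h0' : x + B 0 ω = x := by rw [h0, add_zero]
    have hc' : Continuous fun t => x + B t ω := hc.const_add x
    refine tendsto_pi_nhds.2 fun t => ?_
    have := tendsto_reflectedProcess (X := fun u ω => x + B u ω) (ω := ω) hxy hc' h0' t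
    simp only [Finset.restrict_def]
    rw [reflectPath_eq (X := fun u ω => x + B u ω) hxy hc' h0']
    refine this.congr fun n => ?_
    congr 1
    refine Finset.sum_congr rfl fun j _ => ?_
    rw [add_sub_add_left_eq_sub]
    exact if_congr (staysOnSide_iff_lt_planeHittingTime (X := fun u ω => x + B u ω)
      hxy hc' h0' _).symm rfl rfl
  · filter_upwards [hB.start, hB.continuous] with ω h0 hc
    refine tendsto_pi_nhds.2 fun t => ?_
    refine Tendsto.const_add _ ?_
    refine ((hc.tendsto t).comp (tendsto_floor_div t)).congr fun n => ?_
    rw [Finset.sum_range_sub (fun j : ℕ => B ((j : ℝ≥0) / n) ω)]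
    simp [h0]

/-- Two processes of the form `F ∘ S` and `G ∘ S`, where `F` and `G` have continuous paths, the same
law, and are independent of `S`, have the same law. -/
theorem identDistrib_subordinate [IsProbabilityMeasure P] {E : Type*} [NormedAddCommGroup E] [CompleteSpace E]
    [SecondCountableTopology E] [MeasurableSpace E] [BorelSpace E] {S : ℝ≥0 → Ω → ℝ≥0}
    (hS : ∀ t, Measurable (S t)) {F G : Ω → ℝ≥0 → E} {F' G' : ℝ≥0 → Ω → E}
    (hF : Measurable F) (hG : Measurable G)
    (hFG : P.map F = P.map G) (hFS : IndepFun F (fun ω t => S t ω) P)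
    (hGS : IndepFun G (fun ω t => S t ω) P)
    (hF' : ∀ᵐ ω ∂P, (∀ t, F ω t = F' t ω) ∧ Continuous (F ω))
    (hG' : ∀ᵐ ω ∂P, (∀ t, G ω t = G' t ω) ∧ Continuous (G ω)) :
    IdentDistrib (fun ω t => subordinate F' S t ω) (fun ω t => subordinate G' S t ω) P P := by
  have hSm : Measurable fun ω t => S t ω := measurable_pi_lambda _ hS
  -- Measurability of evaluation at a random time comes from `evalLim`; for continuous paths it is
  -- the true evaluation.
  let Θ : (ℝ≥0 → E) × (ℝ≥0 → ℝ≥0) → ℝ≥0 → E := fun p t => evalLim p.1 (p.2 t)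
  have hΘ : Measurable Θ := measurable_pi_lambda _ fun t => measurable_evalLim.comp
    (measurable_fst.prodMk ((measurable_pi_apply t).comp measurable_snd))
  have hpair : IdentDistrib (fun ω => (F ω, fun t => S t ω)) (fun ω => (G ω, fun t => S t ω)) P P :=
    ⟨(hF.prodMk hSm).aemeasurable, (hG.prodMk hSm).aemeasurable, by
      rw [(indepFun_iff_map_prod_eq_prod_map_map hF.aemeasurable hSm.aemeasurable).1 hFS,
        (indepFun_iff_map_prod_eq_prod_map_map hG.aemeasurable hSm.aemeasurable).1 hGS, hFG]⟩
  have key : ∀ {H : Ω → ℝ≥0 → E} {H' : ℝ≥0 → Ω → E},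
      (∀ᵐ ω ∂P, (∀ t, H ω t = H' t ω) ∧ Continuous (H ω)) →
      (Θ ∘ fun ω => (H ω, fun t => S t ω)) =ᵐ[P] fun ω t => subordinate H' S t ω := by
    intro H H' h
    filter_upwards [h] with ω hω
    ext1 t
    simp only [Θ, Function.comp_apply, evalLim_eq hω.2, subordinate, hω.1]
  have hΘFG := hpair.comp hΘ
  exact ((IdentDistrib.of_ae_eq hΘFG.aemeasurable_fst (key hF')).symm.trans hΘFG).trans
    (IdentDistrib.of_ae_eq hΘFG.aemeasurable_snd (key hG'))

theorem identDistrib_subordinate_reflectedProcess [IsProbabilityMeasure P]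
    (hB : IsBrownianMotion B P)
    {S : ℝ≥0 → Ω → ℝ≥0} (hS : ∀ t, Measurable (S t))
    (hBS : IndepFun (fun ω t => B t ω) (fun ω t => S t ω) P) (hxy : x ≠ y) :
    IdentDistrib (fun ω t => subordinate (reflectedProcess x y (fun s ω => x + B s ω)) S t ω)
      (fun ω t => subordinate (fun s ω => y + B s ω) S t ω) P P := by
  have hadd : ∀ z : EuclideanSpace ℝ (Fin d),
      Measurable fun (b : ℝ≥0 → EuclideanSpace ℝ (Fin d)) t => z + b t := fun z =>
    measurable_pi_lambda _ fun t => by fun_prop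
  have hBm : Measurable fun ω t => B t ω := measurable_pi_lambda _ hB.measurable
  have hrefl := (measurable_reflectPath x y).comp (hadd x)
  refine identDistrib_subordinate hS (hrefl.comp hBm) ((hadd y).comp hBm)
    (hB.map_reflectPath hxy) (hBS.comp hrefl measurable_id)
    (hBS.comp (hadd y) measurable_id) ?_ ?_
  · filter_upwards [hB.start, hB.continuous] with ω h0 hc
    have h0' : x + B 0 ω = x := by rw [h0, add_zero]
    have hc' : Continuous fun t => x + B t ω := hc.const_add x
    have h := reflectPath_eq (X := fun u ω => x + B u ω) hxy hc' h0'
    refine ⟨h, ?_⟩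
    exact (continuous_reflectedProcess (X := fun u ω => x + B u ω) hxy hc' h0').congr
      fun t => (h t).symm
  · filter_upwards [hB.continuous] with ω hc
    exact ⟨fun t => rfl, hc.const_add y⟩

end

/-! ### Gaussian integrals and the function p_t -/

section Gaussian

theorem gaussianReal_zero_real_Ioc {v : ℝ≥0} (hv : v ≠ 0) {a : ℝ} (ha : 0 ≤ a) :
    (gaussianReal 0 v).real (Set.Ioc (-a) a) = 2 * ∫ r in (0 : ℝ)..a, gaussianPDFReal 0 v r := by
  have hint := integrable_gaussianPDFReal 0 v
  have hneg : ∫ r in (-a)..0, gaussianPDFReal 0 v r = ∫ r in (0 : ℝ)..a, gaussianPDFReal 0 v r := by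
    have := intervalIntegral.integral_comp_neg (a := 0) (b := a) (gaussianPDFReal 0 v)
    rw [neg_zero] at this
    rw [← this]
    refine intervalIntegral.integral_congr fun r _ => ?_
    simp [gaussianPDFReal]
  rw [measureReal_def, gaussianReal_apply_eq_integral 0 hv, ENNReal.toReal_ofReal
    (integral_nonneg fun r => gaussianPDFReal_nonneg 0 v r),
    ← intervalIntegral.integral_of_le (by linarith),
    ← intervalIntegral.integral_add_adjacent_intervals (b := 0) hint.intervalIntegrable
      hint.intervalIntegrable, hneg]
  ring

theorem subKernel_eq (d : ℕ) (ν : Measure ℝ) (r : ℝ) :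
    subKernel d ν r = ((2 * Real.pi) ^ (((d : ℝ) - 1) / 2))⁻¹ *
      ∫ s in Set.Ioi (0 : ℝ), gaussianPDFReal 0 s.toNNReal r ∂ν := by
  rw [subKernel, ← integral_const_mul]
  refine setIntegral_congr_fun measurableSet_Ioi fun s hs => ?_
  simp only [gaussianPDFReal, Real.coe_toNNReal s (le_of_lt hs), sub_zero, one_div, neg_div]
  ring

/-- The density is unbounded near r = s = 0, but integrating over r first gives at most 1 for each s
> 0, and ν is finite. -/
theorem integrable_gaussianPDFReal_prod (ν : Measure ℝ) [IsFiniteMeasure ν] (a : ℝ) :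
    Integrable (Function.uncurry fun r s : ℝ => gaussianPDFReal 0 s.toNNReal r)
      ((volume.restrict (Set.Ioc 0 a)).prod (ν.restrict (Set.Ioi 0))) := by
  have hm : Measurable (Function.uncurry fun r s : ℝ => gaussianPDFReal 0 s.toNNReal r) :=
    measurable_uncurry_gaussianPDFReal.comp
      (by fun_prop : Measurable fun p : ℝ × ℝ => ((0 : ℝ), p.2.toNNReal, p.1))
  rw [integrable_prod_iff' hm.aestronglyMeasurable]
  refine ⟨ae_of_all _ fun s => (integrable_gaussianPDFReal 0 s.toNNReal).restrict, ?_⟩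
  refine Integrable.mono' (integrable_const (1 : ℝ))
    (hm.norm.stronglyMeasurable.integral_prod_left').aestronglyMeasurable ?_
  refine (ae_restrict_iff' measurableSet_Ioi).2 (ae_of_all _ fun s hs => ?_)
  have h0 : ∀ r, 0 ≤ gaussianPDFReal 0 s.toNNReal r := gaussianPDFReal_nonneg _ _
  simp only [Function.uncurry_apply_pair, Real.norm_of_nonneg (h0 _)]
  rw [Real.norm_of_nonneg (integral_nonneg h0),
    ← integral_gaussianPDFReal_eq_one 0 (v := s.toNNReal) (by simpa using hs)]
  exact setIntegral_le_integral (integrable_gaussianPDFReal _ _) (ae_of_all _ h0)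

theorem intervalIntegrable_subKernel (d : ℕ) (ν : Measure ℝ) [IsFiniteMeasure ν] {a : ℝ}
    (ha : 0 ≤ a) : IntervalIntegrable (subKernel d ν) volume 0 a := by
  rw [intervalIntegrable_iff_integrableOn_Ioc_of_le ha]
  simp only [funext (subKernel_eq d ν)]
  exact (integrable_gaussianPDFReal_prod ν a).integral_prod_left.const_mul _

theorem integral_subKernel (d : ℕ) (ν : Measure ℝ) [IsFiniteMeasure ν] {a : ℝ} (ha : 0 ≤ a) :
    2 * (2 * Real.pi) ^ (((d : ℝ) - 1) / 2) * ∫ r in (0 : ℝ)..a, subKernel d ν r =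
      ∫ s in Set.Ioi (0 : ℝ), (gaussianReal 0 s.toNNReal).real (Set.Ioc (-a) a) ∂ν := by
  have hc : (2 * Real.pi) ^ (((d : ℝ) - 1) / 2) ≠ 0 := (Real.rpow_pos_of_pos (by positivity) _).ne'
  simp only [subKernel_eq]
  rw [intervalIntegral.integral_const_mul, intervalIntegral.integral_of_le ha,
    integral_integral_swap (integrable_gaussianPDFReal_prod ν a), mul_assoc,
    mul_inv_cancel_left₀ hc, ← integral_const_mul]
  refine setIntegral_congr_fun measurableSet_Ioi fun s hs => ?_
  rw [gaussianReal_zero_real_Ioc (by simpa using hs) ha, intervalIntegral.integral_of_le ha]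

theorem stdGaussian_map_inner {E : Type*} [NormedAddCommGroup E] [InnerProductSpace ℝ E]
    [FiniteDimensional ℝ E] [MeasurableSpace E] [BorelSpace E] {e : E} (he : ‖e‖ = 1) :
    (stdGaussian E).map (fun z => ⟪e, z⟫) = gaussianReal 0 1 := by
  have := IsGaussian.map_eq_gaussianReal (μ := stdGaussian E) (innerSL ℝ e)
  rw [integral_strongDual_stdGaussian, variance_dual_stdGaussian, innerSL_apply_norm, he] at this
  simpa using this

theorem measurable_gaussianReal_var {D : Set ℝ} (hD : MeasurableSet D) :
    Measurable fun s : ℝ≥0 => gaussianReal 0 s D := by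
  have : Measurable fun s : ℝ≥0 => gaussianReal 0 s :=
    measurable_gaussianReal.comp (by fun_prop : Measurable fun s : ℝ≥0 => ((0 : ℝ), s))
  exact (Measure.measurable_coe hD).comp this

end Gaussian

/-! ### Total variation of a coupling separated by a set -/

section TotalVariation

variable {Ω E : Type*} [MeasurableSpace Ω] [MeasurableSpace E] {P : Measure Ω}
  [IsProbabilityMeasure P]

/-- Almost surely, Y ∈ A implies X = Y, hence X ∈ A; so the difference is the probability of X ∈ A,
Y ∉ A, which is the event X ≠ Y. -/
theorem measureReal_mem_sub_of_ae {X Y : Ω → E} (hX : AEMeasurable X P) (hY : AEMeasurable Y P)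
    {A : Set E} (hA : MeasurableSet A) (h : ∀ᵐ ω ∂P, X ω ≠ Y ω → X ω ∈ A ∧ Y ω ∉ A) :
    (P.map X).real A - (P.map Y).real A = P.real {ω | X ω ≠ Y ω} := by
  have hXA : NullMeasurableSet (X ⁻¹' A) P := hX.nullMeasurableSet_preimage hA
  have hYA : NullMeasurableSet (Y ⁻¹' A) P := hY.nullMeasurableSet_preimage hA
  rw [map_measureReal_apply_of_aemeasurable hX hA, map_measureReal_apply_of_aemeasurable hY hA]
  have e1 : ({ω | X ω ≠ Y ω} : Set Ω) =ᵐ[P] (X ⁻¹' A \ Y ⁻¹' A : Set Ω) := by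
    filter_upwards [h] with ω hω
    refine propext ⟨fun hne => hω hne, fun hm he => hm.2 ?_⟩
    change Y ω ∈ A
    exact he ▸ hm.1
  have e2 : (X ⁻¹' A ∩ Y ⁻¹' A : Set Ω) =ᵐ[P] Y ⁻¹' A := by
    filter_upwards [h] with ω hω
    refine propext ⟨fun hm => hm.2, fun hm => ⟨?_, hm⟩⟩
    by_cases hne : X ω = Y ω
    · change X ω ∈ A
      rw [hne]; exact hm
    · exact absurd hm (hω hne).2
  have := measureReal_inter_add_sdiff₀ (μ := P) (s := X ⁻¹' A) hYA
  rw [measureReal_congr e1, ← measureReal_congr e2]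
  linarith

/-- The coupling inequality bounds every set, and A attains the bound. -/
theorem tvDist_eq_of_ae {X Y : Ω → E} (hX : AEMeasurable X P) (hY : AEMeasurable Y P)
    {A : Set E} (hA : MeasurableSet A) (h : ∀ᵐ ω ∂P, X ω ≠ Y ω → X ω ∈ A ∧ Y ω ∉ A) :
    tvDist (P.map X) (P.map Y) = P.real {ω | X ω ≠ Y ω} := by
  have hle : ∀ D : {D : Set E // MeasurableSet D},
      |(P.map X).real D.1 - (P.map Y).real D.1| ≤ P.real {ω | X ω ≠ Y ω} := by
    rintro ⟨D, hD⟩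
    simp only
    rw [map_measureReal_apply_of_aemeasurable hX hD, map_measureReal_apply_of_aemeasurable hY hD]
    have h1 : P.real (X ⁻¹' D) ≤ P.real (Y ⁻¹' D) + P.real {ω | X ω ≠ Y ω} := by
      refine (measureReal_mono ?_).trans (measureReal_union_le _ _)
      intro ω hω
      by_cases hne : X ω = Y ω
      · refine Or.inl ?_
        change Y ω ∈ D
        rw [← hne]; exact hω
      · exact Or.inr hne
    have h2 : P.real (Y ⁻¹' D) ≤ P.real (X ⁻¹' D) + P.real {ω | X ω ≠ Y ω} := by
      refine (measureReal_mono ?_).trans (measureReal_union_le _ _)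
      intro ω hω
      by_cases hne : X ω = Y ω
      · refine Or.inl ?_
        change X ω ∈ D
        rw [hne]; exact hω
      · exact Or.inr hne
    rw [abs_le]
    constructor <;> linarith
  have : Nonempty {D : Set E // MeasurableSet D} := ⟨⟨A, hA⟩⟩
  refine le_antisymm (ciSup_le hle) ?_
  refine le_trans ?_ (le_ciSup ⟨_, Set.forall_mem_range.2 hle⟩ ⟨A, hA⟩)
  rw [← measureReal_mem_sub_of_ae hX hY hA h]
  exact le_abs_self _

end TotalVariation

/-! ### Subordinators and projections of subordinated Brownian motion -/

section

variable {d : ℕ} {Ω : Type*} [MeasurableSpace Ω] {P : Measure Ω}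
  {B : ℝ≥0 → Ω → EuclideanSpace ℝ (Fin d)} {S : ℝ≥0 → Ω → ℝ≥0}
  {x y : EuclideanSpace ℝ (Fin d)}

theorem IsSubordinator.measurable (hS : IsSubordinator S P) (t : ℝ≥0) : Measurable (S t) := by
  simpa [Function.comp_def] using measurable_real_toNNReal.comp (hS.levy.measurable t)

/-- This replaces right-continuity of the paths, which is not assumed: convergence in measure from
the right yields almost sure convergence along a sequence. The level c is quantified inside so that
it may be the random hitting time. -/
theorem IsSubordinator.ae_exists_gt (hS : IsSubordinator S P) (t : ℝ≥0) :
    ∀ᵐ ω ∂P, ∀ c : ℝ≥0∞, (S t ω : ℝ≥0∞) < c → ∃ u > t, (S u ω : ℝ≥0∞) < c := by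
  have h : TendstoInMeasure P (fun t ω => (S t ω : ℝ)) (𝓝[>] t) (fun ω => (S t ω : ℝ)) :=
    fun ε hε => (hS.levy.stochCont t ε hε).mono_left nhdsWithin_le_nhds
  obtain ⟨ns, hns, hae⟩ := h.exists_seq_tendsto_ae'
  filter_upwards [hae] with ω hω c hc
  have h1 : Tendsto (fun i => (S (ns i) ω : ℝ≥0∞)) atTop (𝓝 (S t ω : ℝ≥0∞)) :=
    ENNReal.tendsto_coe.2 (NNReal.tendsto_coe.1 hω)
  obtain ⟨i, hi, hi'⟩ := ((h1.eventually_lt_const hc).and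
    (hns.eventually self_mem_nhdsWithin)).exists
  exact ⟨ns i, hi', hi⟩

theorem IsBrownianMotion.map_inner (hB : IsBrownianMotion B P) {e : EuclideanSpace ℝ (Fin d)}
    (he : ‖e‖ = 1) (s : ℝ≥0) : P.map (fun ω => ⟪e, B s ω⟫) = gaussianReal 0 s := by
  have h1 : P.map (fun ω => ⟪e, B s ω⟫) = P.map (fun ω => ⟪e, B (0 + s) ω - B 0 ω⟫) := by
    refine Measure.map_congr ?_
    filter_upwards [hB.start] with ω hω
    simp [hω]
  have hin : Measurable fun z : EuclideanSpace ℝ (Fin d) => ⟪e, z⟫ := by fun_prop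
  have hsm : Measurable fun z : EuclideanSpace ℝ (Fin d) => √(s : ℝ) • z := by fun_prop
  have h2 : P.map (fun ω => ⟪e, B (0 + s) ω - B 0 ω⟫) =
      (P.map (fun ω => B (0 + s) ω - B 0 ω)).map fun z => ⟪e, z⟫ := by
    rw [Measure.map_map hin (by exact (hB.measurable _).sub (hB.measurable _))]
    rfl
  rw [h1, h2, (hB.gaussian 0 s).map_eq, Measure.map_map hin hsm]
  have h3 : ((fun z : EuclideanSpace ℝ (Fin d) => ⟪e, z⟫) ∘ fun z => √(s : ℝ) • z) =
      (fun r => √(s : ℝ) * r) ∘ fun z => ⟪e, z⟫ := by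
    ext1 z
    simp [inner_smul_right]
  rw [h3, ← Measure.map_map (by fun_prop) hin, stdGaussian_map_inner he,
    gaussianReal_map_const_mul, mul_zero, mul_one]
  congr 1
  ext
  simp

/-- The law of a projection of Brownian motion at an independent random time. -/
theorem IsBrownianMotion.measure_inner_subordinate [IsProbabilityMeasure P]
    (hB : IsBrownianMotion B P) (hS : ∀ t, Measurable (S t))
    (hBS : IndepFun (fun ω t => B t ω) (fun ω t => S t ω) P) {e : EuclideanSpace ℝ (Fin d)}
    (he : ‖e‖ = 1) (t : ℝ≥0) {D : Set ℝ} (hD : MeasurableSet D) :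
    P {ω | ⟪e, B (S t ω) ω⟫ ∈ D} = ∫⁻ s, gaussianReal 0 s D ∂(P.map (S t)) := by
  have hBm : Measurable fun ω t => B t ω := measurable_pi_lambda _ hB.measurable
  have hind : IndepFun (S t) (fun ω t => B t ω) P :=
    (hBS.comp measurable_id (measurable_pi_apply t)).symm
  have hprod := (indepFun_iff_map_prod_eq_prod_map_map (hS t).aemeasurable hBm.aemeasurable).1 hind
  have hG : Measurable fun p : ℝ≥0 × (ℝ≥0 → EuclideanSpace ℝ (Fin d)) => ⟪e, evalLim p.2 p.1⟫ := by
    have := measurable_evalLim (E := EuclideanSpace ℝ (Fin d)).comp measurable_swap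
    exact Measurable.const_inner this
  have h1 : P {ω | ⟪e, B (S t ω) ω⟫ ∈ D} = P.map (fun ω => (S t ω, fun t => B t ω))
      ((fun p : ℝ≥0 × (ℝ≥0 → EuclideanSpace ℝ (Fin d)) => ⟪e, evalLim p.2 p.1⟫) ⁻¹' D) := by
    rw [Measure.map_apply ((hS t).prodMk hBm) (hG hD)]
    refine measure_congr ?_
    filter_upwards [hB.continuous] with ω hω
    refine propext ?_
    change ⟪e, B (S t ω) ω⟫ ∈ D ↔ ⟪e, evalLim (fun t => B t ω) (S t ω)⟫ ∈ D
    rw [evalLim_eq hω]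
  rw [h1, hprod, Measure.prod_apply (hG hD)]
  refine lintegral_congr fun s => ?_
  rw [← hB.map_inner he s, Measure.map_apply hBm (measurable_prodMk_left (hG hD)),
    Measure.map_apply (by exact Measurable.const_inner (hB.measurable s)) hD]
  refine measure_congr ?_
  filter_upwards [hB.continuous] with ω hω
  refine propext ?_
  change ⟪e, evalLim (fun t => B t ω) s⟫ ∈ D ↔ ⟪e, B s ω⟫ ∈ D
  rw [evalLim_eq hω]

theorem IsBrownianMotion.measureReal_inner_subordinate_Ioc [IsProbabilityMeasure P]
    (hB : IsBrownianMotion B P) (hS : ∀ t, Measurable (S t))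
    (hBS : IndepFun (fun ω t => B t ω) (fun ω t => S t ω) P) {e : EuclideanSpace ℝ (Fin d)}
    (he : ‖e‖ = 1) (t : ℝ≥0) {a : ℝ} (ha : 0 < a) :
    P.real {ω | ⟪e, B (S t ω) ω⟫ ∈ Set.Ioc (-a) a} = P.real {ω | S t ω = 0} +
      2 * (2 * Real.pi) ^ (((d : ℝ) - 1) / 2) *
        ∫ r in (0 : ℝ)..a, subKernel d (P.map (fun ω => (S t ω : ℝ))) r := by
  have hSr : Measurable fun ω => (S t ω : ℝ) := measurable_coe_nnreal_real.comp (hS t)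
  have : IsProbabilityMeasure (P.map fun ω => (S t ω : ℝ)) :=
    Measure.isProbabilityMeasure_map hSr.aemeasurable
  have hm := measurable_gaussianReal_var (D := Set.Ioc (-a) a) measurableSet_Ioc
  let f : ℝ → ℝ := fun s => (gaussianReal 0 s.toNNReal).real (Set.Ioc (-a) a)
  have hf : Measurable f := (hm.comp measurable_real_toNNReal).ennreal_toReal
  have hfint : Integrable f (P.map fun ω => (S t ω : ℝ)) := by
    refine Integrable.mono' (integrable_const (1 : ℝ)) hf.aestronglyMeasurable
      (ae_of_all _ fun s => ?_)
    rw [Real.norm_of_nonneg measureReal_nonneg]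
    exact measureReal_le_one
  have h1 : P.real {ω | ⟪e, B (S t ω) ω⟫ ∈ Set.Ioc (-a) a} =
      ∫ s, f s ∂(P.map fun ω => (S t ω : ℝ)) := by
    rw [measureReal_def, hB.measure_inner_subordinate hS hBS he t measurableSet_Ioc,
      integral_map hSr.aemeasurable hf.aestronglyMeasurable, lintegral_map hm (hS t),
      ← integral_toReal (by exact (hm.comp (hS t)).aemeasurable)
        (ae_of_all _ fun ω => measure_lt_top _ _)]
    simp [f, measureReal_def]
  -- At s = 0 the Gaussian degenerates to the point mass at 0, which lies in (-a, a].
  have h2 : ∫ s in (Set.Ioi (0 : ℝ))ᶜ, f s ∂(P.map fun ω => (S t ω : ℝ)) =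
      P.real {ω | S t ω = 0} := by
    have e1 : ∫ s in (Set.Ioi (0 : ℝ))ᶜ, f s ∂(P.map fun ω => (S t ω : ℝ)) =
        ∫ s in (Set.Ioi (0 : ℝ))ᶜ, (1 : ℝ) ∂(P.map fun ω => (S t ω : ℝ)) := by
      refine setIntegral_congr_fun measurableSet_Ioi.compl fun s hs => ?_
      have hs' : s.toNNReal = 0 := Real.toNNReal_eq_zero.2 (not_lt.1 hs)
      simp only [f, hs', gaussianReal_zero_var]
      rw [measureReal_def, Measure.dirac_apply' _ measurableSet_Ioc]
      simp [ha, ha.le]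
    rw [e1, setIntegral_const, smul_eq_mul, mul_one,
      map_measureReal_apply hSr measurableSet_Ioi.compl]
    congr 1
    ext ω
    simp only [Set.mem_preimage, Set.mem_compl_iff, Set.mem_Ioi, not_lt, Set.mem_ofPred_eq]
    exact_mod_cast nonpos_iff_eq_zero
  rw [h1, ← integral_add_compl measurableSet_Ioi hfint, h2, integral_subKernel d _ ha.le, add_comm]

end

/-! ### Coupling time and the separating half-space -/

theorem planeHittingTime_self {Ω E : Type*} [NormedAddCommGroup E] (x : E) (X : ℝ≥0 → Ω → E)
    (ω : Ω) : planeHittingTime x x X ω = 0 := by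
  refine le_antisymm (ENNReal.le_of_forall_pos_le_add fun ε hε _ => ?_) zero_le
  rw [zero_add]
  exact iInf₂_le ε ⟨hε, rfl⟩

theorem reflectedProcess_self {Ω E : Type*} [NormedAddCommGroup E] [InnerProductSpace ℝ E] (x : E)
    (X : ℝ≥0 → Ω → E) : reflectedProcess x x X = X := by
  ext1 t
  ext1 ω
  simp [reflectedProcess, planeHittingTime_self]

/-- Before the hitting time the reflection coupling has its components on the two sides of the
plane, and afterwards they agree. -/
theorem reflectedProcess_cases {Ω E : Type*} [NormedAddCommGroup E] [InnerProductSpace ℝ E]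
    {X : ℝ≥0 → Ω → E} {ω : Ω} {x y : E} (hxy : x ≠ y)
    (hc : Continuous fun t => X t ω) (h0 : X 0 ω = x) (s : ℝ≥0) :
    ((s : ℝ≥0∞) < planeHittingTime x y X ω ∧ 0 < planeSide x y (X s ω) ∧
      planeSide x y (reflectedProcess x y X s ω) < 0) ∨
    (¬ (s : ℝ≥0∞) < planeHittingTime x y X ω ∧ X s ω = reflectedProcess x y X s ω) := by
  by_cases h : (s : ℝ≥0∞) < planeHittingTime x y X ω
  · have hpos := (lt_planeHittingTime_iff hxy hc h0 s).1 h s le_rfl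
    refine Or.inl ⟨h, hpos, ?_⟩
    rw [reflectedProcess, if_pos h, planeSide_planeReflection hxy]
    exact neg_neg_of_pos hpos
  · exact Or.inr ⟨h, by rw [reflectedProcess, if_neg h]⟩

/-- By monotonicity of the clock, the times before meeting form an initial segment. That the infimum
strictly exceeds t needs a later time in this segment, which `ht` provides. -/
theorem lt_couplingTime_iff {Ω E : Type*} {S : ℝ≥0 → Ω → ℝ≥0} {X Y : ℝ≥0 → Ω → E} {ω : Ω} {c : ℝ≥0∞}
    (h : ∀ t, X t ω ≠ Y t ω ↔ (S t ω : ℝ≥0∞) < c) (hmono : Monotone fun t => S t ω) {t : ℝ≥0}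
    (ht : (S t ω : ℝ≥0∞) < c → ∃ u > t, (S u ω : ℝ≥0∞) < c) :
    (t : ℝ≥0∞) < couplingTime X Y ω ↔ X t ω ≠ Y t ω := by
  constructor
  · intro hlt heq
    exact absurd hlt (not_lt.2 (iInf₂_le t heq))
  · intro hne
    obtain ⟨u, hu, huc⟩ := ht ((h t).1 hne)
    refine lt_of_lt_of_le (b := (u : ℝ≥0∞)) (by exact_mod_cast hu) (le_iInf₂ fun w hw => ?_)
    by_contra! hlt
    have hwu : w ≤ u := by exact_mod_cast hlt.le
    refine (h w).2 (lt_of_le_of_lt ?_ huc) hw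
    exact_mod_cast hmono hwu

/-- With the same B in both, the half-space event for y is contained in that for x. The difference
is -|x-y|/2 < ⟨e, B⟩ ≤ |x-y|/2 at time S_t, which explains the half-open interval. -/
theorem IsBrownianMotion.planeSide_measureReal_sub {d : ℕ} {Ω : Type*} [MeasurableSpace Ω]
    {P : Measure Ω} [IsProbabilityMeasure P] {B : ℝ≥0 → Ω → EuclideanSpace ℝ (Fin d)}
    {S : ℝ≥0 → Ω → ℝ≥0} {x y : EuclideanSpace ℝ (Fin d)}
    (hB : IsBrownianMotion B P) (hS : ∀ t, Measurable (S t))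
    (hBS : IndepFun (fun ω t => B t ω) (fun ω t => S t ω) P) (hxy : x ≠ y) (t : ℝ≥0)
    (hX : AEMeasurable (subordinate (fun s ω => x + B s ω) S t) P)
    (hY : AEMeasurable (subordinate (fun s ω => y + B s ω) S t) P) :
    (P.map (subordinate (fun s ω => x + B s ω) S t)).real {z | 0 < planeSide x y z} -
      (P.map (subordinate (fun s ω => y + B s ω) S t)).real {z | 0 < planeSide x y z} =
    P.real {ω | S t ω = 0} + 2 * (2 * Real.pi) ^ (((d : ℝ) - 1) / 2) *
        ∫ r in (0 : ℝ)..(‖x - y‖ / 2), subKernel d (P.map (fun ω => (S t ω : ℝ))) r := by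
  have hn : 0 < ‖x - y‖ := norm_pos_iff.2 (sub_ne_zero.2 hxy)
  have hA : MeasurableSet {z | 0 < planeSide x y z} :=
    measurableSet_lt measurable_const (continuous_planeSide x y).measurable
  have hYA := hY.nullMeasurableSet_preimage hA
  let e := ‖x - y‖⁻¹ • (x - y)
  have he : ‖e‖ = 1 := by
    rw [norm_smul, norm_inv, norm_norm, inv_mul_cancel₀ hn.ne']
  have hin : ∀ b, ⟪b, x - y⟫ = ‖x - y‖ * ⟪e, b⟫ := by
    intro b
    simp only [e, inner_smul_left, conj_trivial]
    rw [mul_inv_cancel_left₀ hn.ne', real_inner_comm]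
  rw [← hB.measureReal_inner_subordinate_Ioc hS hBS he t (half_pos hn),
    map_measureReal_apply_of_aemeasurable hX hA, map_measureReal_apply_of_aemeasurable hY hA]
  have e1 : ∀ b, 0 < planeSide x y (x + b) ↔ -(‖x - y‖ / 2) < ⟪e, b⟫ := by
    intro b
    rw [planeSide_add_left, hin, show ‖x - y‖ * ⟪e, b⟫ + ‖x - y‖ ^ 2 / 2 =
      ‖x - y‖ * (⟪e, b⟫ - -(‖x - y‖ / 2)) by ring, mul_pos_iff_of_pos_left hn, sub_pos]
  have e2 : ∀ b, 0 < planeSide x y (y + b) ↔ ‖x - y‖ / 2 < ⟪e, b⟫ := by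
    intro b
    rw [planeSide_add_right, hin, show ‖x - y‖ * ⟪e, b⟫ - ‖x - y‖ ^ 2 / 2 =
      ‖x - y‖ * (⟪e, b⟫ - ‖x - y‖ / 2) by ring, mul_pos_iff_of_pos_left hn, sub_pos]
  have e3 : {ω | ⟪e, B (S t ω) ω⟫ ∈ Set.Ioc (-(‖x - y‖ / 2)) (‖x - y‖ / 2)} =
      subordinate (fun s ω => x + B s ω) S t ⁻¹' {z | 0 < planeSide x y z} \
        subordinate (fun s ω => y + B s ω) S t ⁻¹' {z | 0 < planeSide x y z} := by
    ext ω
    change _ ∧ _ ↔ 0 < planeSide x y (x + B (S t ω) ω) ∧ ¬ 0 < planeSide x y (y + B (S t ω) ω)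
    rw [e1, e2, not_lt]
  have e4 : subordinate (fun s ω => x + B s ω) S t ⁻¹' {z | 0 < planeSide x y z} ∩
        subordinate (fun s ω => y + B s ω) S t ⁻¹' {z | 0 < planeSide x y z} =
      subordinate (fun s ω => y + B s ω) S t ⁻¹' {z | 0 < planeSide x y z} := by
    refine Set.inter_eq_right.2 fun ω hω => ?_
    change 0 < planeSide x y (y + B (S t ω) ω) at hω
    change 0 < planeSide x y (x + B (S t ω) ω)
    rw [e2] at hω
    rw [e1]
    linarith
  have := measureReal_inter_add_sdiff₀ (μ := P)
    (s := subordinate (fun s ω => x + B s ω) S t ⁻¹' {z | 0 < planeSide x y z}) hYA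
  rw [e3]
  rw [e4] at this
  linarith

/-- `B` is a Brownian motion from `0` and `S` an independent subordinator, so that
`B^z = z + B` and `t ↦ z + B_{S_t}` is subordinated Brownian motion started at `z`. -/
theorem lemma4p1 {d : ℕ} {Ω Ω₁ Ω₂ : Type*}
    [MeasurableSpace Ω] [MeasurableSpace Ω₁] [MeasurableSpace Ω₂]
    (P : Measure Ω) [IsProbabilityMeasure P]
    (P₁ : Measure Ω₁) [IsProbabilityMeasure P₁]
    (P₂ : Measure Ω₂) [IsProbabilityMeasure P₂]
    (B : ℝ≥0 → Ω → EuclideanSpace ℝ (Fin d)) (hB : IsBrownianMotion B P)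
    (S : ℝ≥0 → Ω → ℝ≥0) (hS : IsSubordinator S P)
    (hBS : IndepFun (fun ω t => B t ω) (fun ω t => S t ω) P)
    (x y : EuclideanSpace ℝ (Fin d))
    (Lx : ℝ≥0 → Ω₁ → EuclideanSpace ℝ (Fin d))
    (hLx : IdentDistrib (fun ω t => Lx t ω)
      (fun ω t => subordinate (fun s ω => x + B s ω) S t ω) P₁ P)
    (Ly : ℝ≥0 → Ω₂ → EuclideanSpace ℝ (Fin d))
    (hLy : IdentDistrib (fun ω t => Ly t ω)
      (fun ω t => subordinate (fun s ω => y + B s ω) S t ω) P₂ P)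
    (X Y : ℝ≥0 → Ω → EuclideanSpace ℝ (Fin d))
    (hX : X = subordinate (fun s ω => x + B s ω) S)
    (hY : Y = subordinate (reflectedProcess x y (fun s ω => x + B s ω)) S) :
    (∀ t : ℝ≥0,
      IntervalIntegrable (subKernel d (P.map (fun ω => (S t ω : ℝ)))) volume 0 (‖x - y‖ / 2) ∧
      tvDist (P₁.map (Lx t)) (P₂.map (Ly t)) =
        P.real {ω | S t ω = 0} * (1 - (Measure.dirac x).real {y})
          + 2 * (2 * Real.pi) ^ (((d : ℝ) - 1) / 2)
            * ∫ r in (0 : ℝ)..(‖x - y‖ / 2), subKernel d (P.map (fun ω => (S t ω : ℝ))) r ∧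
      NullMeasurableSet {ω | (t : ℝ≥0∞) < couplingTime X Y ω} P ∧
      tvDist (P₁.map (Lx t)) (P₂.map (Ly t)) =
        P.real {ω | (t : ℝ≥0∞) < couplingTime X Y ω}) ∧
    IsMaximalCoupling X Y P Lx P₁ Ly P₂ := by
  have hSm := hS.measurable
  have heval : ∀ t, Measurable fun f : ℝ≥0 → EuclideanSpace ℝ (Fin d) => f t :=
    fun t => measurable_pi_apply t
  have hYlaw : IdentDistrib (fun ω t => Y t ω)
      (fun ω t => subordinate (fun s ω => y + B s ω) S t ω) P P := by
    rcases eq_or_ne x y with rfl | hxy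
    · rw [hY, reflectedProcess_self]
      exact IdentDistrib.refl hLx.aemeasurable_snd
    · rw [hY]
      exact identDistrib_subordinate_reflectedProcess hB hSm hBS hxy
  have hXlaw : IdentDistrib (fun ω t => X t ω)
      (fun ω t => subordinate (fun s ω => x + B s ω) S t ω) P P := by
    rw [hX]
    exact IdentDistrib.refl hLx.aemeasurable_snd
  have hXm : ∀ t, AEMeasurable (X t) P := fun t => (hXlaw.comp (heval t)).aemeasurable_fst
  have hYm : ∀ t, AEMeasurable (Y t) P := fun t => (hYlaw.comp (heval t)).aemeasurable_fst
  have hLxt : ∀ t, P₁.map (Lx t) = P.map (X t) := fun t =>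
    ((hLx.trans hXlaw.symm).comp (heval t)).map_eq
  have hLyt : ∀ t, P₂.map (Ly t) = P.map (Y t) := fun t =>
    ((hLy.trans hYlaw.symm).comp (heval t)).map_eq
  have hint : ∀ t,
      IntervalIntegrable (subKernel d (P.map (fun ω => (S t ω : ℝ)))) volume 0 (‖x - y‖ / 2) := by
    intro t
    have : IsProbabilityMeasure (P.map fun ω => (S t ω : ℝ)) :=
      Measure.isProbabilityMeasure_map (measurable_coe_nnreal_real.comp (hSm t)).aemeasurable
    exact intervalIntegrable_subKernel d _ (by positivity)
  have hA : MeasurableSet {z | 0 < planeSide x y z} :=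
    measurableSet_lt measurable_const (continuous_planeSide x y).measurable
  have hsides : ∀ᵐ ω ∂P, ∀ t, X t ω ≠ Y t ω → 0 < planeSide x y (X t ω) ∧
      ¬ 0 < planeSide x y (Y t ω) := by
    rcases eq_or_ne x y with rfl | hxy
    · rw [hX, hY, reflectedProcess_self]
      exact ae_of_all _ fun ω t h => absurd rfl h
    · filter_upwards [hB.start, hB.continuous] with ω h0 hc t hne
      rw [hX, hY] at hne ⊢
      rcases reflectedProcess_cases (X := fun s ω => x + B s ω) (ω := ω) hxy (hc.const_add x)
        (by simp [h0]) (S t ω) with h | h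
      · exact ⟨h.2.1, not_lt.2 h.2.2.le⟩
      · exact absurd h.2 hne
  have htime : ∀ t : ℝ≥0, {ω | (t : ℝ≥0∞) < couplingTime X Y ω} =ᵐ[P] {ω | X t ω ≠ Y t ω} := by
    intro t
    have hae : ∀ᵐ ω ∂P, ∀ t, X t ω ≠ Y t ω ↔
        (S t ω : ℝ≥0∞) < planeHittingTime x y (fun s ω => x + B s ω) ω := by
      rcases eq_or_ne x y with rfl | hxy
      · rw [hX, hY, reflectedProcess_self]
        exact ae_of_all _ fun ω t => by simp [planeHittingTime_self]
      · filter_upwards [hB.start, hB.continuous] with ω h0 hc t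
        rw [hX, hY]
        rcases reflectedProcess_cases (X := fun s ω => x + B s ω) (ω := ω) hxy (hc.const_add x)
          (by simp [h0]) (S t ω) with h | h
        · refine iff_of_true (fun heq => ?_) h.1
          change x + B (S t ω) ω = reflectedProcess x y (fun s ω => x + B s ω) (S t ω) ω at heq
          rw [← heq] at h
          exact absurd h.2.1 (not_lt.2 h.2.2.le)
        · exact iff_of_false (not_not.2 h.2) h.1
    filter_upwards [hae, hS.mono, hS.ae_exists_gt t] with ω h hmono hgt
    exact propext (lt_couplingTime_iff h hmono (hgt _))
  have htv : ∀ t, tvDist (P₁.map (Lx t)) (P₂.map (Ly t)) = P.real {ω | X t ω ≠ Y t ω} := by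
    intro t
    rw [hLxt, hLyt]
    exact tvDist_eq_of_ae (hXm t) (hYm t) hA (hsides.mono fun ω h => h t)
  refine ⟨fun t => ⟨hint t, ?_, ?_, ?_⟩, hXlaw.trans hLx.symm, hYlaw.trans hLy.symm, htv⟩
  · rw [htv]
    rcases eq_or_ne x y with rfl | hxy
    -- For x = y the factor of the atom and the length of the integration interval both vanish.
    · rw [hX, hY, reflectedProcess_self]
      simp [measureReal_def]
    · have hd : (Measure.dirac x).real {y} = 0 := by
        rw [measureReal_def, Measure.dirac_apply' _ (measurableSet_singleton y)]
        simp [hxy]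
      -- The half-space probabilities depend on the marginals only, so Y may be replaced by the
      -- translate y + B run along S.
      have hYmap : P.map (Y t) = P.map (subordinate (fun s ω => y + B s ω) S t) :=
        (hYlaw.comp (heval t)).map_eq
      rw [hd, sub_zero, mul_one, ← measureReal_mem_sub_of_ae (hXm t) (hYm t) hA
        (hsides.mono fun ω h => h t), hYmap, hX]
      exact hB.planeSide_measureReal_sub hSm hBS hxy t
        ((hXlaw.comp (heval t)).aemeasurable_snd) ((hYlaw.comp (heval t)).aemeasurable_snd)
  · exact (nullMeasurableSet_eq_fun (hXm t) (hYm t)).compl.congr (htime t).symm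
  · rw [htv, measureReal_congr (htime t)]
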